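/- **Setting.** Let $n,k\ge 0$ be integers. For $x=x_0+\mathbf i x_1+\mathbf j x_2+\mathbf k x_3\in\mathbb H$ put $$\tau(x)=\begin{pmatrix}x_0-ix_1&-x_2+ix_3\\ x_2+ix_3&x_0+ix_1\end{pmatrix},$$ and for a quaternionic matrix $M$ let $\tau(M)$ be the complex matrix with blocks $\tau(M_{lm})$. Let ${\rm SL}(n+1,\mathbb H)$ be the group of invertible quaternionic $(n+1)\times(n+1)$ matrices $g$ with $\det\tau(g)=1$. For $h=\begin{pmatrix}a&b\\c&d\end{pmatrix}\in{\rm SL}(n+1,\mathbb H)$ with $a$ of size $1\times1$, and $q\in\mathbb H^n$ (column vectors) with $a+bq\ne0$, let $$J_1(h,q)=a+bq,\qquad h.q=(c+dq)(a+bq)^{-1},\qquad J_2(h,q)=d-(c+dq)(a+bq)^{-1}b .$$ For $g\in{\rm SL}(n+1,\mathbb H)$ let $\mathcal L_g=\{q\in\mathbb H^n: J_1(g^{-1},q)=0\}$. For $j\ge0$ put $\mathcal V_j=\odot^{k-j}\mathbb C^2\otimes\wedge^j\mathbb C^{2n}$ if $j\le k$ and $\mathcal V_j=\odot^{j-k-1}\mathbb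 C^2\otimes\wedge^{j+1}\mathbb C^{2n}$ if $j>k$. Its elements are written as polynomials, homogeneous of the respective degrees, in two commuting variables (written $s^{0'},s^{1'}$ if $j\le k$ and $S_{0'},S_{1'}$ if $j>k$) and in Grassmannian variables $\omega^0,\dots,\omega^{2n-1}$. For an open set $D\subset\mathbb H^n$ and a smoothness class $C^r$ (finite $r$, $C^\infty$ or real analytic) let $\Gamma^r(D,\mathcal V_j)$ be the space of $C^r$ functions $D\to\mathcal V_j$. With $q_{l+1}=x_{4l}+\mathbf i x_{4l+1}+\mathbf j x_{4l+2}+\mathbf k x_{4l+3}$ $(0\le l<n)$, define $\nabla_{AA'}$ ($0\le A\le 2n-1$, $A'\in\{0',1'\}$) by $$\begin{pmatrix}\nabla_{(2l)0'}&\nabla_{(2l)1'}\\ \nabla_{(2l+1)0'}&\nabla_{(2l+1)1'}\end{pmatrix}=\frac12\begin{pmatrix}\partial_{x_{4l}}+i\partial_{x_{4l+1}}&-\partial_{x_{4l+2}}-i\partial_{x_{4l+3}}\\ \partial_{x_{4l+2}}-i\partial_{x_{4l+3}}&\partial_{x_{4l}}-i\partial_{x_{4l+1}}\end{pmatrix},$$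 and $d_{A'}f=\sum_A\omega^A\,\nabla_{AA'}f$. Let $(\varepsilon^{A'B'})=\begin{pmatrix}0&-1\\1&0\end{pmatrix}$, $\partial^{A'}=\sum_{B'}\varepsilon^{B'A'}\frac{\partial}{\partial s^{B'}}$, $S^{A'}=\sum_{B'}S_{B'}\varepsilon^{B'A'}$. The operators of the $k$-Cauchy–Fueter complex are $$\mathcal D_j=\sum_{A'}\partial^{A'}d_{A'}\ (j<k),\qquad \mathcal D_k=d_{0'}d_{1'},\qquad \mathcal D_j=\sum_{A'}S^{A'}d_{A'}\ (j>k).$$ Let $m_j$ be the order of $\mathcal D_j$ in $q$, i.e. $m_k=2$ and $m_j=1$ for $j\ne k$. A function $f\in\Gamma^{m_0}(D,\mathcal V_0)$ is called $k$-regular on $D$ if $\mathcal D_0f=0$ on $D$. Complex matrices act multiplicatively on polynomials through $M.s^{A'}=\sum_{B'}M_{B'A'}s^{B'}$, $M.S_{A'}=\sum_{B'}M_{B'A'}S_{B'}$, $M.\omega^A=\sum_BM_{BA}\omega^B$; quaternionic matrices act through $\tau$, and $J^t$ means $\tau(J)^t$. For $g\in{\rm SL}(n+1,\mathbb H)$ with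 $g^{-1}=\begin{pmatrix}a&b\\c&d\end{pmatrix}$, $f\in\Gamma^r(D,\mathcal V_j)$ and $q\notin\mathcal L_g$ with $g^{-1}.q\in D$, let $[\pi_j(g)f](q)$ be the element of $\mathcal V_j$ obtained from $|a+bq|^{-2(j+1)}f(g^{-1}.q)$ by letting $J_2(g^{-1},q)^t$ act on the $\omega^A$ and letting $J_1(g^{-1},q)^{-1}$ act on the $s^{A'}$ if $j\le k$, respectively $J_1(g^{-1},q)^t$ act on the $S_{A'}$ if $j>k$. **Theorem.** Let $g\in{\rm SL}(n+1,\mathbb H)$. (1) Let $j\ge0$, let $D\subset\mathbb H^n$ be open (for instance $D=\mathbb H^n$), put $D_g=\{q\notin\mathcal L_g: g^{-1}.q\in D\}$, and let $f\in\Gamma^{r+m_j}(D,\mathcal V_j)$. Then $\mathcal D_jf\in\Gamma^r(D,\mathcal V_{j+1})$, $\pi_j(g)f\in\Gamma^{r+m_j}(D_g,\mathcal V_j)$, and on $D_g$ $$\mathcal D_j(\pi_j(g)f)=\pi_{j+1}(g)\,\mathcal D_jf .$$ (2) If $f$ is $k$-regular on an open set $D\subset\mathbb H^n$, then $$q\longmapsto\frac1{|a+bq|^2}\,(a+bq)^{-1}.\,f\big((c+dq)(a+bq)^{-1}\big)$$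 is $k$-regular on $g.D\setminus\mathcal L_g$, where $g^{-1}=\begin{pmatrix}a&b\\c&d\end{pmatrix}$ and $g.D=\{g.p: p\in D,\ J_1(g,p)\ne0\}$. -/

import Mathlib

namespace CauchyFueter

open scoped Quaternion

noncomputable section

/-! ### The embedding of quaternionic matrices into complex ones -/

/-- The complex `2 × 2` matrix of the quaternion `x₀ + i x₁ + j x₂ + k x₃`. -/
def tau (x : Quaternion ℝ) : Matrix (Fin 2) (Fin 2) ℂ :=
  !![(x.re : ℂ) - Complex.I * x.imI, -(x.imJ : ℂ) + Complex.I * x.imK;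
     (x.imJ : ℂ) + Complex.I * x.imK, (x.re : ℂ) + Complex.I * x.imI]

/-- The complex matrix of a quaternionic matrix, obtained by applying `tau` to every entry. The pair
`(l, α)` stands for the complex row (or column) index `2 l + α`. -/
def tauMat {p m : ℕ} (M : Matrix (Fin p) (Fin m) (Quaternion ℝ)) :
    Matrix (Fin p × Fin 2) (Fin m × Fin 2) ℂ :=
  Matrix.of fun x y => tau (M x.1 y.1) x.2 y.2

lemma tau_mul (x y : Quaternion ℝ) : tau (x * y) = tau x * tau y := by
  have hI := Complex.I_mul_I
  ext i j
  fin_cases i <;> fin_cases j <;> apply Complex.ext <;>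
    simp [tau, Matrix.mul_apply, Fin.sum_univ_two] <;> ring

lemma tau_one : tau 1 = 1 := by
  ext i j
  fin_cases i <;> fin_cases j <;> apply Complex.ext <;> simp [tau]

lemma tau_zero : tau 0 = 0 := by
  ext i j
  fin_cases i <;> fin_cases j <;> apply Complex.ext <;> simp [tau]

lemma tau_add (x y : Quaternion ℝ) : tau (x + y) = tau x + tau y := by
  ext i j
  fin_cases i <;> fin_cases j <;> simp [tau] <;> ring

lemma tau_sum {ι : Type*} (s : Finset ι) (x : ι → Quaternion ℝ) :
    tau (∑ i ∈ s, x i) = ∑ i ∈ s, tau (x i) := by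
  classical
  induction s using Finset.induction_on with
  | empty => simp [tau_zero]
  | insert a s ha ih => rw [Finset.sum_insert ha, Finset.sum_insert ha, tau_add, ih]

lemma tauMat_mul {p m l : ℕ} (M : Matrix (Fin p) (Fin m) (Quaternion ℝ))
    (N : Matrix (Fin m) (Fin l) (Quaternion ℝ)) : tauMat (M * N) = tauMat M * tauMat N := by
  ext x y
  simp only [tauMat, Matrix.of_apply, Matrix.mul_apply, tau_sum, tau_mul, Matrix.sum_apply,
    Fintype.sum_prod_type]

lemma tauMat_one (p : ℕ) : tauMat (1 : Matrix (Fin p) (Fin p) (Quaternion ℝ)) = 1 := by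
  ext ⟨i, a⟩ ⟨j, b⟩
  by_cases h : i = j
  · subst h
    simp [tauMat, tau_one, Matrix.one_apply]
  · simp [tauMat, Matrix.one_apply, h, tau_zero]

/-! ### The group `SL(n + 1, ℍ)` and its action on `ℍⁿ` -/

/-- `SL(n + 1, ℍ)`: the invertible quaternionic matrices whose complex matrix has determinant `1`. -/
def SLH (n : ℕ) : Subgroup (Matrix (Fin (n + 1)) (Fin (n + 1)) (Quaternion ℝ))ˣ where
  carrier := {g | (tauMat g.val).det = 1}
  mul_mem' := by
    intro g h hg hh
    simp only [Set.mem_ofPred_eq] at hg hh ⊢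
    rw [Units.val_mul, tauMat_mul, Matrix.det_mul, hg, hh, one_mul]
  one_mem' := by
    simp [tauMat_one]
  inv_mem' := by
    intro g hg
    simp only [Set.mem_ofPred_eq] at hg ⊢
    have h : (tauMat (g * g⁻¹).val).det = 1 := by simp [tauMat_one]
    rw [Units.val_mul, tauMat_mul, Matrix.det_mul, hg, one_mul] at h
    exact h

/-- The space `ℍⁿ` of quaternionic column vectors. -/
abbrev Hn (n : ℕ) : Type := Fin n → Quaternion ℝ

variable {n : ℕ}

/-- The entries of the block matrix `h = (a b; c d)`, with `a` of size `1 × 1`. -/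
def blockA (h : SLH n) : Quaternion ℝ := h.val.val 0 0

/-- The block `b` of `h = (a b; c d)`. -/
def blockB (h : SLH n) (m : Fin n) : Quaternion ℝ := h.val.val 0 m.succ

/-- The block `c` of `h = (a b; c d)`. -/
def blockC (h : SLH n) (l : Fin n) : Quaternion ℝ := h.val.val l.succ 0

/-- The block `d` of `h = (a b; c d)`. -/
def blockD (h : SLH n) (l m : Fin n) : Quaternion ℝ := h.val.val l.succ m.succ

/-- The cocycle `J₁(h, q) = a + b q`, for `h = (a b; c d)`. -/
def J1 (h : SLH n) (q : Hn n) : Quaternion ℝ := blockA h + ∑ m, blockB h m * q m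

/-- The fractional linear map `h.q = (c + d q) (a + b q)⁻¹`, for `h = (a b; c d)`. -/
def act (h : SLH n) (q : Hn n) : Hn n :=
  fun l => (blockC h l + ∑ m, blockD h l m * q m) * (J1 h q)⁻¹

/-- The cocycle `J₂(h, q) = d - (c + d q) (a + b q)⁻¹ b`, for `h = (a b; c d)`. -/
def J2 (h : SLH n) (q : Hn n) : Matrix (Fin n) (Fin n) (Quaternion ℝ) :=
  Matrix.of fun l m =>
    blockD h l m - (blockC h l + ∑ r, blockD h l r * q r) * (J1 h q)⁻¹ * blockB h m

/-- The quaternionic hyperplane `{q | a + b q = 0}`, where `g⁻¹ = (a b; c d)`. -/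
def singularSet (g : SLH n) : Set (Hn n) := {q | J1 g⁻¹ q = 0}

/-- The image `g.D` of a set `D` under the fractional linear map of `g`, where it is defined. -/
def image (g : SLH n) (D : Set (Hn n)) : Set (Hn n) := {q | ∃ p ∈ D, J1 g p ≠ 0 ∧ act g p = q}

/-- The points outside the singular hyperplane of `g` that `g⁻¹` maps into `D`. -/
def regularSet (g : SLH n) (D : Set (Hn n)) : Set (Hn n) :=
  {q | q ∉ singularSet g ∧ act g⁻¹ q ∈ D}

/-! ### The spaces `𝒱_j` -/

/-- `∧^τ ℂ²ⁿ`, realized as homogeneous polynomials of degree `τ` in Grassmannian variables `ω^A`: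
alternating `τ`-forms on `ℂ²ⁿ`, where `ω^A` is the `A`-th coordinate function and the product of the
`ω^A` is the wedge product. The index `A = (l, α)` stands for `2 l + α`. -/
abbrev Lam (n τ : ℕ) : Type := (Fin n × Fin 2 → ℂ) [⋀^Fin τ]→L[ℂ] ℂ

/-- The degree in `ω^A` of the elements of `𝒱_j`. -/
def extDeg (k j : ℕ) : ℕ := if j ≤ k then j else j + 1

/-- The degree in `s^{A'}` (if `j ≤ k`) or in `S_{A'}` (if `j > k`) of the elements of `𝒱_j`. -/
def symDeg (k j : ℕ) : ℕ := if j ≤ k then k - j else j - k - 1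

/-- Functions of `q ∈ ℍⁿ` and of two complex variables (`s^{0'}, s^{1'}`, or `S_{0'}, S_{1'}`), with
values in `∧^τ ℂ²ⁿ`. -/
abbrev SuperFun (n τ : ℕ) : Type := Hn n → (Fin 2 → ℂ) → Lam n τ

/-- `p` is a homogeneous polynomial of degree `σ` in two complex variables, with coefficients in `E`;
these functions realize `⊙^σ ℂ² ⊗ E`. -/
def IsHomogeneousPoly {E : Type*} [AddCommGroup E] [Module ℂ E] (σ : ℕ)
    (p : (Fin 2 → ℂ) → E) : Prop :=
  ∃ c : Fin (σ + 1) → E, ∀ s, p s = ∑ i : Fin (σ + 1), (s 0 ^ (i : ℕ) * s 1 ^ (σ - i)) • c i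

/-- `Γ(D, 𝒱_j)`, with class of smoothness `C^r`: on `D`, the function `f` has values in
`𝒱_j = ⊙^{symDeg k j} ℂ² ⊗ ∧^{extDeg k j} ℂ²ⁿ` and depends on `q` in a `C^r` way (in the real sense). -/
def IsSection (k j : ℕ) (r : WithTop ℕ∞) (D : Set (Hn n)) (f : SuperFun n (extDeg k j)) : Prop :=
  (∀ q ∈ D, IsHomogeneousPoly (symDeg k j) (f q)) ∧ ∀ s, ContDiffOn ℝ r (fun q => f q s) D

/-- Transport of forms along an equality of degrees. -/
def castDeg {a b : ℕ} (h : a = b) (φ : Lam n a) : Lam n b := h ▸ φ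

/-! ### The operators of the `k`-Cauchy–Fueter complex -/

/-- The quaternion `i`. -/
def unitI : Quaternion ℝ := ⟨0, 1, 0, 0⟩

/-- The quaternion `j`. -/
def unitJ : Quaternion ℝ := ⟨0, 0, 1, 0⟩

/-- The quaternion `k`. -/
def unitK : Quaternion ℝ := ⟨0, 0, 0, 1⟩

/-- The partial derivative with respect to the real coordinate of `q_l` along the quaternion `e`. -/
def partialX {E : Type*} [NormedAddCommGroup E] [NormedSpace ℝ E] (l : Fin n) (e : Quaternion ℝ)
    (F : Hn n → E) (q : Hn n) : E :=
  fderiv ℝ F q (Pi.single l e)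

/-- The complex first-order operators `∇_{AA'}`, `A = (l, α)`: for fixed `l` they form the matrix
`½ (∂₀ + i ∂₁, -∂₂ - i ∂₃; ∂₂ - i ∂₃, ∂₀ - i ∂₁)` in the real coordinates of
`q_l = x₀ + i x₁ + j x₂ + k x₃`. -/
def nabla {E : Type*} [NormedAddCommGroup E] [NormedSpace ℝ E] [Module ℂ E]
    (A : Fin n × Fin 2) (A' : Fin 2) (F : Hn n → E) (q : Hn n) : E :=
  let d0 := partialX A.1 1 F q
  let d1 := partialX A.1 unitI F q
  let d2 := partialX A.1 unitJ F q
  let d3 := partialX A.1 unitK F q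
  (1 / 2 : ℂ) •
    (!![d0 + Complex.I • d1, -d2 - Complex.I • d3;
        d2 - Complex.I • d3, d0 - Complex.I • d1] : Matrix (Fin 2) (Fin 2) E) A.2 A'

/-- `ω^A ∧ φ`. -/
def wedge {τ : ℕ} (A : Fin n × Fin 2) (φ : Lam n τ) : Lam n (τ + 1) :=
  ContinuousAlternatingMap.alternatizeUncurryFin
    ((ContinuousLinearMap.proj (R := ℂ) (φ := fun _ : Fin n × Fin 2 => ℂ) A).smulRight φ)

/-- `d_{A'} f = ∑_A ω^A ∧ ∇_{AA'} f`. -/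
def dOp {τ : ℕ} (A' : Fin 2) (f : SuperFun n τ) : SuperFun n (τ + 1) :=
  fun q s => ∑ A, wedge A (nabla A A' (fun p => f p s) q)

/-- The matrix `ε^{A'B'}`, used to raise primed indices: `X^{A'} = ∑_{B'} X_{B'} ε^{B'A'}`. -/
def eps : Matrix (Fin 2) (Fin 2) ℂ := !![0, -1; 1, 0]

/-- The operator `∂^{A'} = ∑_{B'} ε^{B'A'} ∂/∂s^{B'}`. -/
def dUp {τ : ℕ} (A' : Fin 2) (f : SuperFun n τ) : SuperFun n τ :=
  fun q s => ∑ B', eps B' A' • fderiv ℂ (f q) s (Pi.single B' 1)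

/-- Multiplication by `S^{A'} = ∑_{B'} S_{B'} ε^{B'A'}`. -/
def mulSUp {τ : ℕ} (A' : Fin 2) (f : SuperFun n τ) : SuperFun n τ :=
  fun q s => ∑ B', (s B' * eps B' A') • f q s

/-- The operator `𝒟_j` of the `k`-Cauchy–Fueter complex: `∂^{A'} d_{A'}` for `j < k`, `d_{0'} d_{1'}`
for `j = k` and `S^{A'} d_{A'}` for `j > k`. -/
def cauchyFueter (k j : ℕ) (f : SuperFun n (extDeg k j)) : SuperFun n (extDeg k (j + 1)) :=
  if h : j < k then
    fun q s => castDeg (by unfold extDeg; split_ifs <;> omega)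
      (∑ A', dUp A' (dOp A' f) q s)
  else if h' : j = k then
    fun q s => castDeg (by unfold extDeg; split_ifs <;> omega)
      (dOp 0 (dOp 1 f) q s)
  else
    fun q s => castDeg (by unfold extDeg; split_ifs <;> omega)
      (∑ A', mulSUp A' (dOp A' f) q s)

/-- The order of the differential operator `𝒟_j` in the variable `q`. -/
def order (k j : ℕ) : ℕ := if j = k then 2 else 1

/-- A function is `k`-regular on `D` if it is a `𝒱_0`-valued function on `D`, differentiable to the
order of `𝒟_0`, with `𝒟_0 f = 0` on `D`. -/
def IsRegularOn (k : ℕ) (D : Set (Hn n)) (f : SuperFun n (extDeg k 0)) : Prop :=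
  IsSection k 0 (order k 0) D f ∧ ∀ q ∈ D, cauchyFueter k 0 f q = 0

/-! ### The action `π_j` -/

/-- The action of a complex `2 × 2` matrix on polynomials in the coordinate functions `s^{A'}` (or
`S_{A'}`), extending `M.s^{A'} = ∑_{B'} M_{B'A'} s^{B'}` multiplicatively. -/
def actS {E : Type*} (M : Matrix (Fin 2) (Fin 2) ℂ) (p : (Fin 2 → ℂ) → E) : (Fin 2 → ℂ) → E :=
  fun s => p fun A' => ∑ B', M B' A' * s B'

/-- The action of a complex `2n × 2n` matrix on forms, extending
`M.ω^A = ∑_B M_{BA} ω^B` multiplicatively. -/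
def actOmega {τ : ℕ} (M : Matrix (Fin n × Fin 2) (Fin n × Fin 2) ℂ) (φ : Lam n τ) : Lam n τ :=
  φ.compContinuousLinearMap (LinearMap.toContinuousLinearMap (Matrix.toLin' M.transpose))

/-- The action `π_j(g)`: with `g⁻¹ = (a b; c d)`, the value at `q` is obtained from `f (g⁻¹.q)` by
letting `J₁(g⁻¹, q)⁻¹` act on `s^{A'}` (if `j ≤ k`) or the transpose of `J₁(g⁻¹, q)` act on `S_{A'}`
(if `j > k`), letting the transpose of `J₂(g⁻¹, q)` act on `ω^A`, and dividing by
`|a + b q|^{2 (j + 1)}`. Quaternionic matrices act through their complex matrices. -/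
def piAct (k j : ℕ) (g : SLH n) (f : SuperFun n (extDeg k j)) : SuperFun n (extDeg k j) :=
  fun q s =>
    (‖J1 g⁻¹ q‖ ^ (2 * (j + 1)))⁻¹ •
      actOmega (tauMat (J2 g⁻¹ q)).transpose
        (actS (if j ≤ k then tau (J1 g⁻¹ q)⁻¹ else (tau (J1 g⁻¹ q)).transpose)
          (f (act g⁻¹ q)) s)

end

end CauchyFueter

open scoped Quaternion Topology ContDiff
open ContinuousAlternatingMap (alternatizeUncurryFin alternatizeUncurryFinCLM)

namespace CauchyFueter

noncomputable section

variable {n : ℕ}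

/-! ### Complexified derivatives -/

/-! A real linear map `L` on `ℍⁿ` splits uniquely as `L v = ∑ P_{A'} (col_{A'} v)`, where `col_{A'}
v` is a column of `τ(v)` and each `P_{A'}` is complex linear on `ℂ²ⁿ` (`apply_eq_sum_complexPart`,
`eq_complexPart_of_forall`). For the derivative of a function the coefficients of `P_{A'}` are its
`∇_{AA'}`, so `d_{A'}` is the alternatization of `P_{A'}`, and equivariance becomes a calculus of
such decompositions (`HasComplexDeriv`).

Let `h = g⁻¹`, `k = τ(J₁⁻¹)`, and let `β_{A'}` be the rows of `τ(J₁⁻¹ b)`. The derivatives of the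
cocycles close up: the `C'`-parts are `-k_{C'B'} β_{A'}` for `k_{A'B'}`, `-β_{A'} ⊗ β_{C'}` for
`β_{A'}`, `-β_{C'} ⊗ J₂` for `J₂`, and `-e (det k)^e β_{C'}` for `(det k)^e = |J₁|^{-2e}`. The
derivative of `q ↦ h.q` is `v ↦ J₂ v J₁⁻¹`. Therefore, for a `τ`-form `f`, `d_{C'} ((det k)^e J₂^*(f
∘ h)) = (det k)^e (∑ k_{C'B'} J₂^*((d_{B'} f) ∘ h) + (τ - e) β_{C'} ∧ J₂^*(f ∘ h))`, plus a term
from the substitution in `s` or `S` (`exists_hasComplexDeriv_twist_act`, `dForm_twist_pair`).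

The error terms disappear for three different reasons. For `j < k` one has `e = τ + 1`, and the
error together with the substitution term is the `s^{C'}`-derivative of one function, which the
antisymmetric operator `∂^{A'}` kills (`sum_dUp_dOp_twist`). For `j > k` one has `e = τ`, and the
substitution term is `S_{C'}` times something independent of `C'`, which contraction with `S^{A'}`
kills (`sum_mulSUp_dOp_twist`). For `j = k` the `β`-terms of the two successive derivatives cancel
(`dForm_dForm_twist`). What survives is antisymmetric in the primed indices, so `k` enters through
`det k`, the extra factor `|J₁|^{-2}` in `π_{j+1}`.

Smoothness is checked on polynomial coefficients (`IsPolyFamily`). Part (2) is `j = 0` of part (1),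
since `g.D` minus the singular hyperplane lies in the set where `g⁻¹` maps into `D`. -/

/-- The space `ℂ²ⁿ`. -/
abbrev Cn (n : ℕ) : Type := Fin n × Fin 2 → ℂ

/-- The columns of `tau`, extended to `ℍⁿ → ℂ²ⁿ`. -/
def colLM (A' : Fin 2) : Hn n →ₗ[ℝ] Cn n where
  toFun v := fun A => tau (v A.1) A.2 A'
  map_add' v w := by
    ext A
    simp [tau_add]
  map_smul' c v := by
    ext ⟨l, α⟩
    fin_cases A' <;> fin_cases α <;> simp [tau] <;> ring

/-- The columns of `tau` as continuous linear maps. -/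
def col (A' : Fin 2) : Hn n →L[ℝ] Cn n := LinearMap.toContinuousLinearMap (colLM A')

lemma col_apply (A' : Fin 2) (v : Hn n) (A : Fin n × Fin 2) :
    col A' v A = tau (v A.1) A.2 A' := rfl

section Complexify

variable {E : Type*} [NormedAddCommGroup E] [NormedSpace ℂ E]

lemma clm_cn_ext {P Q : Cn n →L[ℂ] E} (h : ∀ A, P (Pi.single A 1) = Q (Pi.single A 1)) :
    P = Q := by
  apply ContinuousLinearMap.coe_injective
  exact LinearMap.pi_ext' fun A => LinearMap.ext_ring (by simpa using h A)

variable [NormedSpace ℝ E]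

/-- The coefficient of the complexification of a real linear map at the matrix unit `(A, A')`. -/
def complexCoeff (L : Hn n →L[ℝ] E) (A : Fin n × Fin 2) (A' : Fin 2) : E :=
  let d0 := L (Pi.single A.1 1)
  let d1 := L (Pi.single A.1 unitI)
  let d2 := L (Pi.single A.1 unitJ)
  let d3 := L (Pi.single A.1 unitK)
  (1 / 2 : ℂ) •
    (!![d0 + Complex.I • d1, -d2 - Complex.I • d3;
        d2 - Complex.I • d3, d0 - Complex.I • d1] : Matrix (Fin 2) (Fin 2) E) A.2 A'

/-- The part of the complexification of a real linear map on the column `A'`. -/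
def complexPart (A' : Fin 2) (L : Hn n →L[ℝ] E) : Cn n →L[ℂ] E :=
  ∑ A, (ContinuousLinearMap.proj (R := ℂ) (φ := fun _ : Fin n × Fin 2 => ℂ) A).smulRight
    (complexCoeff L A A')

lemma complexPart_apply (A' : Fin 2) (L : Hn n →L[ℝ] E) (w : Cn n) :
    complexPart A' L w = ∑ A, w A • complexCoeff L A A' := by
  simp [complexPart]

lemma complexPart_single (A' : Fin 2) (L : Hn n →L[ℝ] E) (A : Fin n × Fin 2) :
    complexPart A' L (Pi.single A 1) = complexCoeff L A A' := by
  simp [complexPart_apply, Pi.single_apply]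

lemma nabla_eq (A : Fin n × Fin 2) (A' : Fin 2) (F : Hn n → E) (q : Hn n) :
    nabla A A' F q = complexCoeff (fderiv ℝ F q) A A' := rfl

lemma col_single (A' : Fin 2) (l : Fin n) (x : ℍ[ℝ]) :
    col A' (Pi.single l x) =
      tau x 0 A' • Pi.single (l, 0) (1 : ℂ) + tau x 1 A' • Pi.single (l, 1) (1 : ℂ) := by
  ext ⟨m, α⟩
  by_cases h : m = l
  · subst h
    fin_cases α <;> simp [col_apply]
  · simp [col_apply, tau_zero, h]

lemma tau_unitI : tau unitI = !![-Complex.I, 0; 0, Complex.I] := by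
  simp [tau, unitI]

lemma tau_unitJ : tau unitJ = !![0, -1; 1, 0] := by
  simp [tau, unitJ]

lemma tau_unitK : tau unitK = !![0, Complex.I; Complex.I, 0] := by
  simp [tau, unitK]

lemma col_single_one (A' : Fin 2) (l : Fin n) :
    col A' (Pi.single l 1) = Pi.single (l, A') 1 := by
  rw [col_single, tau_one]
  fin_cases A' <;> simp [Matrix.one_apply]

lemma col_single_unitI (A' : Fin 2) (l : Fin n) :
    col A' (Pi.single l unitI) = (![-Complex.I, Complex.I] A') • Pi.single (l, A') (1 : ℂ) := by
  rw [col_single, tau_unitI]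
  fin_cases A' <;> simp

lemma col_single_unitJ (A' : Fin 2) (l : Fin n) :
    col A' (Pi.single l unitJ) = ((![1, -1] : Fin 2 → ℂ) A') • Pi.single (l, 1 - A') (1 : ℂ) := by
  rw [col_single, tau_unitJ]
  fin_cases A' <;> simp

lemma col_single_unitK (A' : Fin 2) (l : Fin n) :
    col A' (Pi.single l unitK) = Complex.I • Pi.single (l, 1 - A') (1 : ℂ) := by
  rw [col_single, tau_unitK]
  fin_cases A' <;> simp

/-- Uniqueness of the splitting. On the slot `l` each of `1, i, j, k` has as columns multiples of
basis vectors, and the combinations in `complexCoeff` isolate a single basis vector in a single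
column. -/
lemma eq_complexPart_of_forall {L : Hn n →L[ℝ] E} {P : Fin 2 → Cn n →L[ℂ] E}
    (h : ∀ v, L v = ∑ A', P A' (col A' v)) (A' : Fin 2) : complexPart A' L = P A' := by
  apply clm_cn_ext
  rintro ⟨l, α⟩
  rw [complexPart_single]
  simp only [complexCoeff, h, col_single_one, col_single_unitI, col_single_unitJ,
    col_single_unitK, map_smul, Fin.sum_univ_two]
  fin_cases A' <;> fin_cases α <;> simp [smul_smul] <;> module

lemma exists_eq_smul_units (x : ℍ[ℝ]) :
    ∃ a b c d : ℝ, x = a • (1 : ℍ[ℝ]) + b • unitI + c • unitJ + d • unitK := by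
  refine ⟨x.re, x.imI, x.imJ, x.imK, ?_⟩
  have hI : unitI.re = 0 ∧ unitI.imI = 1 ∧ unitI.imJ = 0 ∧ unitI.imK = 0 := ⟨rfl, rfl, rfl, rfl⟩
  have hJ : unitJ.re = 0 ∧ unitJ.imI = 0 ∧ unitJ.imJ = 1 ∧ unitJ.imK = 0 := ⟨rfl, rfl, rfl, rfl⟩
  have hK : unitK.re = 0 ∧ unitK.imI = 0 ∧ unitK.imJ = 0 ∧ unitK.imK = 1 := ⟨rfl, rfl, rfl, rfl⟩
  ext <;> simp [hI, hJ, hK]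

/-- Existence of the splitting: by real linearity it reduces to the four units in one slot. -/
lemma apply_eq_sum_complexPart [IsScalarTower ℝ ℂ E] (L : Hn n →L[ℝ] E) (v : Hn n) :
    L v = ∑ A', complexPart A' L (col A' v) := by
  have key : ∀ l (x : ℍ[ℝ]), L (Pi.single l x) =
      ∑ A', complexPart A' L (col A' (Pi.single l x)) := by
    intro l x
    obtain ⟨a, b, c, d, rfl⟩ := exists_eq_smul_units x
    simp only [Pi.single_add, Pi.single_smul]
    simp only [map_add, map_smul, col_single_one, col_single_unitI, col_single_unitJ,
      col_single_unitK, Fin.sum_univ_two]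
    have hr (t : ℝ) (w : Cn n) : t • w = (t : ℂ) • w := (Complex.coe_smul t w).symm
    have hr' (t : ℝ) (w : E) : t • w = (t : ℂ) • w := by
      rw [← one_smul ℂ w, ← smul_assoc, smul_smul]
      simp
    simp only [hr, hr', map_smul, complexPart_single, complexCoeff]
    simp [-Complex.coe_smul, -Complex.real_smul, smul_smul, smul_add, smul_sub]
    match_scalars <;> ring_nf <;> simp
  have hv : v = ∑ l, Pi.single l (v l) := (Finset.univ_sum_single v).symm
  rw [hv]
  simp only [_root_.map_sum, key]
  rw [Finset.sum_comm]

/-- `F` is differentiable at `q` in the real sense, and its derivative is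
`v ↦ ∑_{A'} P_{A'} (col_{A'} v)`. -/
def HasComplexDeriv (F : Hn n → E) (P : Fin 2 → Cn n →L[ℂ] E) (q : Hn n) : Prop :=
  ∃ L : Hn n →L[ℝ] E, HasFDerivAt F L q ∧ ∀ v, L v = ∑ A', P A' (col A' v)

lemma HasComplexDeriv.of_hasFDerivAt [IsScalarTower ℝ ℂ E] {F : Hn n → E} {L : Hn n →L[ℝ] E} {q : Hn n}
    (h : HasFDerivAt F L q) : HasComplexDeriv F (fun A' => complexPart A' L) q :=
  ⟨L, h, apply_eq_sum_complexPart L⟩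

lemma HasComplexDeriv.complexPart_fderiv {F : Hn n → E} {P : Fin 2 → Cn n →L[ℂ] E} {q : Hn n}
    (h : HasComplexDeriv F P q) (A' : Fin 2) : complexPart A' (fderiv ℝ F q) = P A' := by
  obtain ⟨L, hL, hP⟩ := h
  rw [hL.fderiv, eq_complexPart_of_forall hP]

end Complexify

end

noncomputable section

variable {n : ℕ}

/-! ### Exterior multiplication and pullback -/

/-- Exterior multiplication of a form by a covector, as a bilinear map. -/
def extMul (n τ : ℕ) : (Cn n →L[ℂ] ℂ) →L[ℂ] Lam n τ →L[ℂ] Lam n (τ + 1) :=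
  (ContinuousLinearMap.compL ℂ (Lam n τ) (Cn n →L[ℂ] Lam n τ) (Lam n (τ + 1))
    (alternatizeUncurryFinCLM ℂ (Cn n) ℂ)).comp
      (ContinuousLinearMap.smulRightL ℂ (Cn n) (Lam n τ))

section Forms

variable {τ : ℕ}

lemma extMul_apply (β : Cn n →L[ℂ] ℂ) (φ : Lam n τ) :
    extMul n τ β φ = alternatizeUncurryFin (β.smulRight φ) := rfl

/-- Pullback of forms, as a linear map in the form. -/
def pull (M : Cn n →L[ℂ] Cn n) : Lam n τ →L[ℂ] Lam n τ :=
  ContinuousAlternatingMap.compContinuousLinearMapCLM M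

lemma pull_apply (M : Cn n →L[ℂ] Cn n) (φ : Lam n τ) :
    pull M φ = φ.compContinuousLinearMap M := rfl

lemma alternatize_sum {ι : Type*} (s : Finset ι) (P : ι → Cn n →L[ℂ] Lam n τ) :
    alternatizeUncurryFin (∑ i ∈ s, P i) = ∑ i ∈ s, alternatizeUncurryFin (P i) :=
  _root_.map_sum (alternatizeUncurryFinCLM ℂ (Cn n) ℂ) P s

lemma alternatize_neg (P : Cn n →L[ℂ] Lam n τ) :
    alternatizeUncurryFin (-P) = -alternatizeUncurryFin P :=
  _root_.map_neg (alternatizeUncurryFinCLM ℂ (Cn n) ℂ) P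

/-- Naturality of alternatization. The inner `M` is what the derivative of `act` contributes, so
pulling back by `J₂` commutes with `d_{A'}` up to the factor `k`. -/
lemma pull_alternatize (M : Cn n →L[ℂ] Cn n) (P : Cn n →L[ℂ] Lam n τ) :
    pull M (alternatizeUncurryFin P) = alternatizeUncurryFin ((pull M).comp (P.comp M)) := by
  ext v
  simp only [pull_apply, ContinuousAlternatingMap.compContinuousLinearMap_apply,
    ContinuousAlternatingMap.alternatizeUncurryFin_apply, ContinuousLinearMap.comp_apply]
  rfl

/-- The symmetric bilinear map `β x P y + β y P x` is built so that its double alternatization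
vanishes; this encodes the anticommutation of covectors. -/
lemma exists_symmetrization {V W : Type*} [NormedAddCommGroup V] [NormedSpace ℂ V]
    [NormedAddCommGroup W] [NormedSpace ℂ W] (β : V →L[ℂ] ℂ) (P : V →L[ℂ] W) :
    ∃ S : V →L[ℂ] V →L[ℂ] W, ∀ x, S x = β x • P + β.smulRight (P x) :=
  ⟨β.smulRight P + (ContinuousLinearMap.smulRightL ℂ V W β).comp P, fun x => by ext y; simp⟩

lemma alternatize_extMul_comp (β : Cn n →L[ℂ] ℂ) (P : Cn n →L[ℂ] Lam n τ) :
    alternatizeUncurryFin ((extMul n τ β).comp P) =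
      -extMul n (τ + 1) β (alternatizeUncurryFin P) := by
  obtain ⟨S, hS⟩ := exists_symmetrization β P
  have h0 : alternatizeUncurryFin ((alternatizeUncurryFinCLM ℂ (Cn n) ℂ).comp S) = 0 := by
    apply ContinuousAlternatingMap.alternatizeUncurryFin_alternatizeUncurryFinCLM_comp_of_symmetric
    intro x y
    simp [hS, add_comm]
  have h1 : (alternatizeUncurryFinCLM ℂ (Cn n) ℂ).comp S =
      β.smulRight (alternatizeUncurryFin P) + (extMul n τ β).comp P := by
    ext1 x
    simp [hS, extMul_apply]
  rw [h1, ContinuousAlternatingMap.alternatizeUncurryFin_add, ← extMul_apply] at h0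
  exact eq_neg_of_add_eq_zero_right h0

/-- Varying `M` by `β ⊗ M w` replaces each argument `M x` in turn by `β(x) M w`; the sum of these is
`β` wedged with the contraction of `M^*φ` by `w`. -/
lemma fderivComp_smulRight (φ : Lam n (τ + 1)) (M : Cn n →L[ℂ] Cn n) (β : Cn n →L[ℂ] ℂ)
    (w : Cn n) :
    φ.fderivCompContinuousLinearMap M (β.smulRight (M w)) =
      extMul n τ β ((pull M φ).curryLeft w) := by
  rw [ContinuousAlternatingMap.fderivCompContinuousLinearMap_eq_alternatizeUncurryFin, extMul_apply]
  simp only [ContinuousLinearMap.comp_apply, ContinuousAlternatingMap.alternatizeUncurryFinCLM_apply]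
  congr 1
  ext x v
  simp only [ContinuousLinearMap.postcomp_apply, ContinuousLinearMap.comp_apply,
    ContinuousLinearMap.smulRight_apply, map_smul, pull_apply]
  simp only [ContinuousAlternatingMap.smul_apply]
  congr 1
  simp [Function.comp_def]

/-- The total contraction of the derivative of the pullback along `x ↦ β ⊗ M x`. -/
lemma alternatize_fderivComp_smulRight (φ : Lam n τ) (M : Cn n →L[ℂ] Cn n) (β : Cn n →L[ℂ] ℂ) :
    alternatizeUncurryFin ((φ.fderivCompContinuousLinearMap M).comp
      ((ContinuousLinearMap.smulRightL ℂ (Cn n) (Cn n) β).comp M)) =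
      -((τ : ℂ) • extMul n τ β (pull M φ)) := by
  cases τ with
  | zero =>
    simp [ContinuousAlternatingMap.fderivCompContinuousLinearMap_of_isEmpty,
      ← ContinuousAlternatingMap.alternatizeUncurryFinCLM_apply]
  | succ τ =>
    have : (φ.fderivCompContinuousLinearMap M).comp
        ((ContinuousLinearMap.smulRightL ℂ (Cn n) (Cn n) β).comp M) =
        (extMul n τ β).comp (pull M φ).curryLeft := by
      ext1 w
      exact fderivComp_smulRight φ M β w
    -- Moving `β` to the front gives the sign; then Euler's identity, `∑ ω^A ∧ ι_A = degree`, gives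
    -- the factor.
    rw [this, alternatize_extMul_comp, ContinuousAlternatingMap.alternatizeUncurryFin_curryLeft]
    have hc : (τ + 1) • pull M φ = ((τ + 1 : ℕ) : ℂ) • pull M φ :=
      (Nat.cast_smul_eq_nsmul ℂ _ _).symm
    rw [hc, map_smul]

end Forms

/-! ### Rules for complexified derivatives -/

section Rules

variable {E F G : Type*} [NormedAddCommGroup E] [NormedSpace ℂ E] [NormedSpace ℝ E]
  [NormedAddCommGroup F] [NormedSpace ℂ F] [NormedSpace ℝ F]

lemma HasComplexDeriv.differentiableAt {f : Hn n → E} {P : Fin 2 → Cn n →L[ℂ] E} {q : Hn n}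
    (h : HasComplexDeriv f P q) : DifferentiableAt ℝ f q :=
  h.choose_spec.1.differentiableAt

lemma HasComplexDeriv.congr_of_eventuallyEq {f g : Hn n → E} {P : Fin 2 → Cn n →L[ℂ] E} {q : Hn n}
    (h : HasComplexDeriv f P q) (hg : g =ᶠ[𝓝 q] f) : HasComplexDeriv g P q := by
  obtain ⟨L, hL, hP⟩ := h
  exact ⟨L, hL.congr_of_eventuallyEq hg, hP⟩

lemma HasComplexDeriv.congr_deriv {f : Hn n → E} {P Q : Fin 2 → Cn n →L[ℂ] E} {q : Hn n}
    (h : HasComplexDeriv f P q) (hPQ : ∀ A', P A' = Q A') : HasComplexDeriv f Q q := by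
  obtain rfl : P = Q := funext hPQ
  exact h

lemma HasComplexDeriv.const (e : E) (q : Hn n) : HasComplexDeriv (fun _ => e) 0 q :=
  ⟨0, hasFDerivAt_const e q, fun v => by simp⟩

lemma HasComplexDeriv.prodMk {f : Hn n → E} {g : Hn n → F} {P : Fin 2 → Cn n →L[ℂ] E}
    {Q : Fin 2 → Cn n →L[ℂ] F} {q : Hn n} (hf : HasComplexDeriv f P q)
    (hg : HasComplexDeriv g Q q) :
    HasComplexDeriv (fun p => (f p, g p)) (fun A' => (P A').prod (Q A')) q := by
  obtain ⟨L, hL, hP⟩ := hf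
  obtain ⟨L', hL', hQ⟩ := hg
  refine ⟨L.prod L', hL.prodMk hL', fun v => ?_⟩
  simp [hP, hQ]

lemma HasComplexDeriv.add {f g : Hn n → E} {P Q : Fin 2 → Cn n →L[ℂ] E} {q : Hn n}
    (hf : HasComplexDeriv f P q) (hg : HasComplexDeriv g Q q) :
    HasComplexDeriv (fun p => f p + g p) (fun A' => P A' + Q A') q := by
  obtain ⟨L, hL, hP⟩ := hf
  obtain ⟨L', hL', hQ⟩ := hg
  refine ⟨L + L', hL.add hL', fun v => ?_⟩
  simp [hP, hQ]
  abel

/-- Precomposition with a map of `ℍⁿ` whose derivative is `v ↦ M v k` in complex notation. -/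
lemma HasComplexDeriv.comp_right {f : Hn n → E} {P : Fin 2 → Cn n →L[ℂ] E} {φ : Hn n → Hn n}
    {L : Hn n →L[ℝ] Hn n} {q : Hn n} {k : Matrix (Fin 2) (Fin 2) ℂ} {M : Cn n →L[ℂ] Cn n}
    (hf : HasComplexDeriv f P (φ q)) (hφ : HasFDerivAt φ L q)
    (hL : ∀ v B', col B' (L v) = ∑ A', k A' B' • M (col A' v)) :
    HasComplexDeriv (fun p => f (φ p)) (fun A' => ∑ B', k A' B' • (P B').comp M) q := by
  obtain ⟨Lf, hLf, hP⟩ := hf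
  refine ⟨Lf.comp L, hLf.comp q hφ, fun v => ?_⟩
  simp only [ContinuousLinearMap.comp_apply, hP, hL, Fin.sum_univ_two, map_add, map_smul,
    _root_.add_apply, _root_.smul_apply]
  abel

lemma HasComplexDeriv.sum {ι : Type*} (s : Finset ι) {f : ι → Hn n → E}
    {P : ι → Fin 2 → Cn n →L[ℂ] E} {q : Hn n} (hf : ∀ i ∈ s, HasComplexDeriv (f i) (P i) q) :
    HasComplexDeriv (fun p => ∑ i ∈ s, f i p) (fun A' => ∑ i ∈ s, P i A') q := by
  classical
  induction s using Finset.induction_on with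
  | empty => exact HasComplexDeriv.const (0 : E) q
  | insert a s ha ih =>
    simp only [Finset.sum_insert ha]
    exact (hf a (by simp)).add (ih fun i hi => hf i (by simp [hi]))

variable [IsScalarTower ℝ ℂ E] [IsScalarTower ℝ ℂ F]

lemma HasComplexDeriv.comp_left {f : Hn n → E} {P : Fin 2 → Cn n →L[ℂ] E} {q : Hn n} {g : E → F}
    {T : E →L[ℂ] F} (hf : HasComplexDeriv f P q) (hg : HasFDerivAt g T (f q)) :
    HasComplexDeriv (fun p => g (f p)) (fun A' => T.comp (P A')) q := by
  obtain ⟨L, hL, hP⟩ := hf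
  refine ⟨(T.restrictScalars ℝ).comp L, (hg.restrictScalars ℝ).comp q hL, fun v => ?_⟩
  simp [hP]

lemma HasComplexDeriv.clm {f : Hn n → E} {P : Fin 2 → Cn n →L[ℂ] E} {q : Hn n} (T : E →L[ℂ] F)
    (hf : HasComplexDeriv f P q) :
    HasComplexDeriv (fun p => T (f p)) (fun A' => T.comp (P A')) q :=
  hf.comp_left T.hasFDerivAt

lemma HasComplexDeriv.neg {f : Hn n → E} {P : Fin 2 → Cn n →L[ℂ] E} {q : Hn n}
    (hf : HasComplexDeriv f P q) : HasComplexDeriv (fun p => -f p) (fun A' => -P A') q := by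
  refine (hf.clm (-ContinuousLinearMap.id ℂ E)).congr_deriv fun A' => ?_
  ext
  simp

variable [NormedAddCommGroup G] [NormedSpace ℂ G] [NormedSpace ℝ G] [IsScalarTower ℝ ℂ G]

lemma HasComplexDeriv.bilin (B : E →L[ℂ] F →L[ℂ] G) {f : Hn n → E} {g : Hn n → F}
    {P : Fin 2 → Cn n →L[ℂ] E} {Q : Fin 2 → Cn n →L[ℂ] F} {q : Hn n} (hf : HasComplexDeriv f P q)
    (hg : HasComplexDeriv g Q q) :
    HasComplexDeriv (fun p => B (f p) (g p))
      (fun A' => (B.flip (g q)).comp (P A') + (B (f q)).comp (Q A')) q := by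
  have h := (hf.prodMk hg).comp_left (B.isBoundedBilinearMap.hasFDerivAt (f q, g q))
  refine h.congr_deriv fun A' => ?_
  ext x
  simp [IsBoundedBilinearMap.deriv]
  abel

lemma HasComplexDeriv.smul {f : Hn n → ℂ} {g : Hn n → E}
    {P : Fin 2 → Cn n →L[ℂ] ℂ} {Q : Fin 2 → Cn n →L[ℂ] E} {q : Hn n} (hf : HasComplexDeriv f P q)
    (hg : HasComplexDeriv g Q q) :
    HasComplexDeriv (fun p => f p • g p) (fun A' => (P A').smulRight (g q) + f q • Q A') q := by
  refine (HasComplexDeriv.bilin (ContinuousLinearMap.lsmul ℂ ℂ) hf hg).congr_deriv fun A' => ?_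
  ext x
  simp

/-- Pullback of a form-valued function along a family of linear maps. -/
lemma HasComplexDeriv.pull {τ : ℕ} {f : Hn n → Lam n τ} {M : Hn n → Cn n →L[ℂ] Cn n}
    {P : Fin 2 → Cn n →L[ℂ] Lam n τ} {Q : Fin 2 → Cn n →L[ℂ] Cn n →L[ℂ] Cn n} {q : Hn n}
    (hf : HasComplexDeriv f P q) (hM : HasComplexDeriv M Q q) :
    HasComplexDeriv (fun p => CauchyFueter.pull (M p) (f p))
      (fun A' => (CauchyFueter.pull (M q)).comp (P A') +
        ((f q).fderivCompContinuousLinearMap (M q)).comp (Q A')) q := by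
  have h := (hf.prodMk hM).comp_left
    (ContinuousAlternatingMap.hasStrictFDerivAt_compContinuousLinearMap (f q, M q)).hasFDerivAt
  refine h.congr_deriv fun A' => ?_
  ext1 x
  simp [CauchyFueter.pull]

end Rules

/-! ### The operators `d_{A'}` on form-valued functions -/

section DForm

variable {τ : ℕ}

/-- The operator `d_{A'}` on form-valued functions of `q` alone. -/
def dForm (A' : Fin 2) (f : Hn n → Lam n τ) (q : Hn n) : Lam n (τ + 1) :=
  alternatizeUncurryFin (complexPart A' (fderiv ℝ f q))

lemma dOp_eq_dForm (A' : Fin 2) (f : SuperFun n τ) (q : Hn n) (s : Fin 2 → ℂ) :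
    dOp A' f q s = dForm A' (fun p => f p s) q := by
  simp only [dOp, dForm, complexPart, alternatize_sum, nabla_eq, wedge]

lemma HasComplexDeriv.dForm_eq {f : Hn n → Lam n τ} {P : Fin 2 → Cn n →L[ℂ] Lam n τ} {q : Hn n}
    (h : HasComplexDeriv f P q) (A' : Fin 2) : dForm A' f q = alternatizeUncurryFin (P A') := by
  rw [dForm, h.complexPart_fderiv]

end DForm

end

noncomputable section

variable {n : ℕ}

/-! ### The cocycles in complex notation -/

/-- The complex matrix of `J₁⁻¹`. -/
def kMat (h : SLH n) (q : Hn n) : Matrix (Fin 2) (Fin 2) ℂ := tau (J1 h q)⁻¹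

/-- The rows of the complex matrix of the block `b`, as covectors on `ℂ²ⁿ`. -/
def bCov (h : SLH n) (B' : Fin 2) : Cn n →L[ℂ] ℂ :=
  ∑ A : Fin n × Fin 2, tau (blockB h A.1) B' A.2 •
    ContinuousLinearMap.proj (R := ℂ) (φ := fun _ : Fin n × Fin 2 => ℂ) A

/-- The rows of the complex matrix of `J₁⁻¹ b`, as covectors on `ℂ²ⁿ`. -/
def beta (h : SLH n) (q : Hn n) (A' : Fin 2) : Cn n →L[ℂ] ℂ :=
  ∑ B', kMat h q A' B' • bCov h B'

/-- The complex linear map of `J₂`. -/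
def jMap (h : SLH n) (q : Hn n) : Cn n →L[ℂ] Cn n :=
  LinearMap.toContinuousLinearMap (Matrix.toLin' (tauMat (J2 h q)))

lemma jMap_apply (h : SLH n) (q : Hn n) (w : Cn n) (A : Fin n × Fin 2) :
    jMap h q w A = ∑ l, ∑ γ, tau (J2 h q A.1 l) A.2 γ * w (l, γ) := by
  simp [jMap, Matrix.mulVec, dotProduct, tauMat, Fintype.sum_prod_type]

lemma bCov_apply (h : SLH n) (B' : Fin 2) (w : Cn n) :
    bCov h B' w = ∑ l, ∑ γ, tau (blockB h l) B' γ * w (l, γ) := by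
  simp [bCov, Fintype.sum_prod_type]

lemma actOmega_eq_pull {τ : ℕ} (h : SLH n) (q : Hn n) (φ : Lam n τ) :
    actOmega (tauMat (J2 h q)).transpose φ = pull (jMap h q) φ := rfl

lemma tau_sub (x y : ℍ[ℝ]) : tau (x - y) = tau x - tau y := by
  rw [eq_sub_iff_add_eq, ← tau_add, sub_add_cancel]

lemma tau_neg (x : ℍ[ℝ]) : tau (-x) = -tau x := by
  rw [← zero_sub, tau_sub, tau_zero, zero_sub]

lemma det_tau (x : ℍ[ℝ]) : (tau x).det = ((‖x‖ ^ 2 : ℝ) : ℂ) := by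
  rw [pow_two, ← Quaternion.normSq_eq_norm_mul_self, Quaternion.normSq_def']
  have hI := Complex.I_sq
  rw [Matrix.det_fin_two]
  simp [tau]
  ring_nf
  rw [hI]
  ring

lemma det_kMat (h : SLH n) (q : Hn n) : (kMat h q).det = (((‖J1 h q‖ ^ 2)⁻¹ : ℝ) : ℂ) := by
  rw [kMat, det_tau, norm_inv, inv_pow]

/-- The entry `∑ b_m v_m` of a product with the block `b`. -/
lemma bCov_col (h : SLH n) (v : Hn n) (A' B' : Fin 2) :
    bCov h B' (col A' v) = tau (∑ m, blockB h m * v m) B' A' := by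
  simp [bCov_apply, tau_sum, tau_mul, Matrix.sum_apply, Matrix.mul_apply, col_apply]

lemma beta_apply (h : SLH n) (q : Hn n) (A' : Fin 2) (w : Cn n) :
    beta h q A' w = ∑ B', kMat h q A' B' * bCov h B' w := by
  simp [beta]

lemma beta_col (h : SLH n) (q v : Hn n) (A' B' : Fin 2) :
    beta h q B' (col A' v) = tau ((J1 h q)⁻¹ * ∑ m, blockB h m * v m) B' A' := by
  rw [beta_apply, tau_mul, Matrix.mul_apply]
  simp only [bCov_col]
  rfl

/-- The linear map `v ↦ b v`. -/
def bLin (h : SLH n) : Hn n →L[ℝ] ℍ[ℝ] :=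
  ∑ m, (ContinuousLinearMap.mul ℝ ℍ[ℝ] (blockB h m)).comp
    (ContinuousLinearMap.proj (R := ℝ) (φ := fun _ : Fin n => ℍ[ℝ]) m)

lemma bLin_apply (h : SLH n) (v : Hn n) : bLin h v = ∑ m, blockB h m * v m := by
  simp [bLin]

/-- The linear map `v ↦ d v`, row by row. -/
def dLin (h : SLH n) (l : Fin n) : Hn n →L[ℝ] ℍ[ℝ] :=
  ∑ m, (ContinuousLinearMap.mul ℝ ℍ[ℝ] (blockD h l m)).comp
    (ContinuousLinearMap.proj (R := ℝ) (φ := fun _ : Fin n => ℍ[ℝ]) m)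

lemma dLin_apply (h : SLH n) (l : Fin n) (v : Hn n) : dLin h l v = ∑ m, blockD h l m * v m := by
  simp [dLin]

lemma J1_eq (h : SLH n) : J1 h = fun q => blockA h + bLin h q := by
  ext1 q
  rw [J1, bLin_apply]

lemma act_eq (h : SLH n) (q : Hn n) (l : Fin n) :
    act h q l = (blockC h l + dLin h l q) * (J1 h q)⁻¹ := by
  rw [act, dLin_apply]

lemma J2_eq (h : SLH n) (q : Hn n) (l m : Fin n) :
    J2 h q l m = blockD h l m - act h q l * blockB h m := rfl

lemma hasFDerivAt_J1 (h : SLH n) (q : Hn n) : HasFDerivAt (J1 h) (bLin h) q := by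
  rw [J1_eq]
  exact (bLin h).hasFDerivAt.const_add _

variable {h : SLH n} {q : Hn n}

lemma hasFDerivAt_J1_inv (hq : J1 h q ≠ 0) :
    HasFDerivAt (fun p => (J1 h p)⁻¹)
      ((-ContinuousLinearMap.mulLeftRight ℝ ℍ[ℝ] (J1 h q)⁻¹ (J1 h q)⁻¹).comp (bLin h)) q :=
  (hasFDerivAt_inv' hq).comp q (hasFDerivAt_J1 h q)

/-- The derivative of the fractional linear map is `v ↦ J₂ v J₁⁻¹`. -/
lemma exists_hasFDerivAt_act (hq : J1 h q ≠ 0) :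
    ∃ L : Hn n →L[ℝ] Hn n, HasFDerivAt (act h) L q ∧
      ∀ v l, L v l = (∑ m, J2 h q l m * v m) * (J1 h q)⁻¹ := by
  have key (l : Fin n) := ((dLin h l).hasFDerivAt (x := q)).const_add (blockC h l) |>.mul'
    (hasFDerivAt_J1_inv hq)
  refine ⟨_, hasFDerivAt_pi.2 fun l => (key l).congr_of_eventuallyEq
    (Filter.Eventually.of_forall fun p => act_eq h p l), fun v l => ?_⟩
  simp only [ContinuousLinearMap.pi_apply, _root_.add_apply, _root_.smul_apply,
    ContinuousLinearMap.comp_apply, _root_.neg_apply,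
    ContinuousLinearMap.mulLeftRight_apply, J2_eq, act_eq, sub_mul, Finset.sum_sub_distrib,
    bLin_apply, smul_eq_mul]
  rw [← dLin_apply]
  simp only [mul_assoc, ← Finset.mul_sum, mul_neg]
  rw [neg_add_eq_sub]
  rfl

lemma col_deriv_act {L : Hn n →L[ℝ] Hn n}
    (hL : ∀ v l, L v l = (∑ m, J2 h q l m * v m) * (J1 h q)⁻¹) (v : Hn n) (B' : Fin 2) :
    col B' (L v) = ∑ A', kMat h q A' B' • jMap h q (col A' v) := by
  ext A
  simp only [col_apply, hL, tau_mul, tau_sum, Matrix.mul_apply, Matrix.sum_apply,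
    Finset.sum_apply, Pi.smul_apply, smul_eq_mul, jMap_apply, kMat]
  exact Finset.sum_congr rfl fun _ _ => mul_comm _ _

lemma hasComplexDeriv_comp_act {E : Type*} [NormedAddCommGroup E] [NormedSpace ℂ E]
    [NormedSpace ℝ E] {f : Hn n → E} {P : Fin 2 → Cn n →L[ℂ] E} (hq : J1 h q ≠ 0)
    (hf : HasComplexDeriv f P (act h q)) :
    HasComplexDeriv (fun p => f (act h p))
      (fun A' => ∑ B', kMat h q A' B' • (P B').comp (jMap h q)) q := by
  obtain ⟨L, hL, hL'⟩ := exists_hasFDerivAt_act hq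
  exact hf.comp_right hL (col_deriv_act hL')

/-- Evaluation of `tau` at an entry, as a real linear map. -/
def tauEntry (A' B' : Fin 2) : ℍ[ℝ] →L[ℝ] ℂ :=
  LinearMap.toContinuousLinearMap
    { toFun := fun x => tau x A' B'
      map_add' := fun x y => by simp [tau_add]
      map_smul' := fun c x => by
        fin_cases A' <;> fin_cases B' <;> simp [tau] <;> ring }

lemma tauEntry_apply (A' B' : Fin 2) (x : ℍ[ℝ]) : tauEntry A' B' x = tau x A' B' := rfl

/-- From `d(J₁⁻¹) v = -(J₁⁻¹ b v) J₁⁻¹`: the column index of `v` is contracted with the right-hand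
factor `J₁⁻¹`. -/
lemma hasComplexDeriv_kMat (hq : J1 h q ≠ 0) (A' B' : Fin 2) :
    HasComplexDeriv (fun p => kMat h p A' B') (fun C' => -(kMat h q C' B' • beta h q A')) q := by
  refine ⟨_, (tauEntry A' B').hasFDerivAt.comp q (hasFDerivAt_J1_inv hq), fun v => ?_⟩
  simp only [ContinuousLinearMap.comp_apply, _root_.neg_apply, _root_.smul_apply,
    ContinuousLinearMap.mulLeftRight_apply, tauEntry_apply, beta_col, tau_neg, Matrix.neg_apply,
    bLin_apply, Finset.sum_neg_distrib, smul_eq_mul]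
  rw [tau_mul, Matrix.mul_apply]
  simp only [mul_comm, kMat]

lemma hasComplexDeriv_beta (hq : J1 h q ≠ 0) (A' : Fin 2) :
    HasComplexDeriv (fun p => beta h p A')
      (fun C' => -((beta h q A').smulRight (beta h q C'))) q := by
  have key := HasComplexDeriv.sum Finset.univ (q := q) (f := fun B' p => kMat h p A' B' • bCov h B')
    fun B' _ => (hasComplexDeriv_kMat hq A' B').smul (HasComplexDeriv.const (bCov h B') q)
  refine key.congr_deriv fun C' => ?_
  ext1 w
  simp [beta]
  module

lemma col_act_mul (h : SLH n) (q : Hn n) (w : Cn n) (A : Fin n × Fin 2) :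
    (∑ B', bCov h B' w • col B' (act h q)) A =
      ∑ l, ∑ γ, tau (act h q A.1 * blockB h l) A.2 γ * w (l, γ) := by
  simp only [Finset.sum_apply, Pi.smul_apply, smul_eq_mul, bCov_apply, col_apply, tau_mul,
    Matrix.mul_apply, Finset.sum_mul]
  rw [Finset.sum_comm]
  refine Finset.sum_congr rfl fun l _ => ?_
  rw [Finset.sum_comm]
  exact Finset.sum_congr rfl fun γ _ => Finset.sum_congr rfl fun _ _ => by ring

lemma jMap_eq (h : SLH n) (q : Hn n) :
    jMap h q = LinearMap.toContinuousLinearMap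
        (Matrix.toLin' (tauMat (Matrix.of fun l m => blockD h l m))) -
      ∑ B', (bCov h B').smulRight (col B' (act h q)) := by
  ext1 w
  ext A
  have h1 := col_act_mul h q w A
  simp only [_root_.sub_apply, _root_.sum_apply, ContinuousLinearMap.smulRight_apply,
    Pi.sub_apply]
  rw [h1, jMap_apply]
  simp [J2_eq, tau_sub, sub_mul, Finset.sum_sub_distrib, Matrix.mulVec, dotProduct, tauMat,
    Fintype.sum_prod_type]

/-- Since `J₂ = d - (h.q) b` with `b`, `d` constant, its derivative is `-(J₂ v J₁⁻¹) b`, a sum of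
rank-one maps. This is exactly the shape that `alternatize_fderivComp_smulRight` handles. -/
lemma hasComplexDeriv_jMap (hq : J1 h q ≠ 0) :
    HasComplexDeriv (jMap h)
      (fun C' => -(ContinuousLinearMap.smulRightL ℂ (Cn n) (Cn n) (beta h q C')).comp (jMap h q))
      q := by
  obtain ⟨L, hL, hL'⟩ := exists_hasFDerivAt_act hq
  have hcol (B' : Fin 2) : HasComplexDeriv (fun p => col B' (act h p))
      (fun C' => kMat h q C' B' • jMap h q) q :=
    ⟨_, (col B').hasFDerivAt.comp q hL, fun v => col_deriv_act hL' v B'⟩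
  have h1 := (HasComplexDeriv.sum Finset.univ
    (f := fun B' p => (bCov h B').smulRight (col B' (act h p))) fun B' _ => (hcol B').clm
      (ContinuousLinearMap.smulRightL ℂ (Cn n) (Cn n) (bCov h B'))).neg
  have h2 := (HasComplexDeriv.const (LinearMap.toContinuousLinearMap
        (Matrix.toLin' (tauMat (Matrix.of fun l m => blockD h l m)))) q).add h1
  have h3 := h2.congr_of_eventuallyEq (g := jMap h)
    (Filter.Eventually.of_forall fun p => by rw [jMap_eq, sub_eq_add_neg])
  refine h3.congr_deriv fun C' => ?_
  ext1 w
  ext1 x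
  simp [beta_apply]
  module

lemma hasComplexDeriv_det_pow (hq : J1 h q ≠ 0) (e : ℕ) :
    HasComplexDeriv (fun p => (kMat h p).det ^ e)
      (fun C' => -((e : ℂ) • (kMat h q).det ^ e • beta h q C')) q := by
  have hk := fun A' B' => hasComplexDeriv_kMat hq A' B'
  have hdet : HasComplexDeriv (fun p => (kMat h p).det)
      (fun C' => -((kMat h q).det • beta h q C')) q := by
    have h1 := ((hk 0 0).smul (hk 1 1)).add ((hk 0 1).smul (hk 1 0)).neg
    refine (h1.congr_of_eventuallyEq (g := fun p => (kMat h p).det)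
      (Filter.Eventually.of_forall fun p => ?_)).congr_deriv fun C' => ?_
    · simp [Matrix.det_fin_two, sub_eq_add_neg]
    · ext1 w
      -- In the product rule the coefficient of the other `β` is a determinant with two equal rows,
      -- so only `β_{C'}` remains.
      fin_cases C' <;> simp [Matrix.det_fin_two] <;> ring
  have h2 := hdet.comp_left ((hasDerivAt_pow e (kMat h q).det).hasFDerivAt)
  refine h2.congr_deriv fun C' => ?_
  ext1 w
  cases e with
  | zero => simp
  | succ e =>
    simp
    ring

end

noncomputable section

variable {n : ℕ} {h : SLH n} {q : Hn n} {τ : ℕ}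

/-! ### Transformation of `d_{A'}` -/

lemma HasComplexDeriv.pi {ι : Type*} [Fintype ι] {f : Hn n → ι → ℂ}
    {P : ι → Fin 2 → Cn n →L[ℂ] ℂ} (hf : ∀ i, HasComplexDeriv (fun p => f p i) (P i) q) :
    HasComplexDeriv f (fun A' => ContinuousLinearMap.pi fun i => P i A') q := by
  choose L hL hP using hf
  refine ⟨_, hasFDerivAt_pi.2 hL, fun v => ?_⟩
  ext i
  simp [hP]

lemma alternatize_smul (c : ℂ) (P : Cn n →L[ℂ] Lam n τ) :
    alternatizeUncurryFin (c • P) = c • alternatizeUncurryFin P :=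
  map_smul (alternatizeUncurryFinCLM ℂ (Cn n) ℂ) c P

/-- The multiplier `|J₁|^{-2e} J₂^*` applied to a form-valued function. -/
def twist (h : SLH n) (e : ℕ) (F : Hn n → Lam n τ) (q : Hn n) : Lam n τ :=
  (kMat h q).det ^ e • pull (jMap h q) (F q)

/-- The error coefficient `τ - e` collects `+τ` from differentiating `J₂` inside the pullback and
`-e` from differentiating `(det k)^e`. -/
lemma exists_hasComplexDeriv_twist (hq : J1 h q ≠ 0) (e : ℕ) {F : Hn n → Lam n τ}
    {P : Fin 2 → Cn n →L[ℂ] Lam n τ} (hF : HasComplexDeriv F P q) :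
    ∃ Q, HasComplexDeriv (twist h e F) Q q ∧ ∀ C', alternatizeUncurryFin (Q C') =
      (kMat h q).det ^ e • (alternatizeUncurryFin ((pull (jMap h q)).comp (P C')) +
        ((τ : ℂ) - e) • extMul n τ (beta h q C') (pull (jMap h q) (F q))) := by
  refine ⟨_, (hasComplexDeriv_det_pow hq e).smul (hF.pull (hasComplexDeriv_jMap hq)),
    fun C' => ?_⟩
  have h1 : (-((e : ℂ) • (kMat h q).det ^ e • beta h q C')).smulRight (pull (jMap h q) (F q)) =
      (-((e : ℂ) * (kMat h q).det ^ e)) • (beta h q C').smulRight (pull (jMap h q) (F q)) := by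
    ext1 x
    simp [smul_smul]
    module
  have h2 : ((F q).fderivCompContinuousLinearMap (jMap h q)).comp
      (-(ContinuousLinearMap.smulRightL ℂ (Cn n) (Cn n) (beta h q C')).comp (jMap h q)) =
      -(((F q).fderivCompContinuousLinearMap (jMap h q)).comp
        ((ContinuousLinearMap.smulRightL ℂ (Cn n) (Cn n) (beta h q C')).comp (jMap h q))) := by
    ext1 x
    simp
  rw [h1, h2, ContinuousAlternatingMap.alternatizeUncurryFin_add, alternatize_smul,
    alternatize_smul, ContinuousAlternatingMap.alternatizeUncurryFin_add, alternatize_neg,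
    alternatize_fderivComp_smulRight, ← extMul_apply]
  module

lemma alternatize_pull_sum_comp (c : Fin 2 → ℂ) (M : Cn n →L[ℂ] Cn n)
    (P : Fin 2 → Cn n →L[ℂ] Lam n τ) :
    alternatizeUncurryFin ((pull M).comp (∑ B', c B' • (P B').comp M)) =
      ∑ B', c B' • pull M (alternatizeUncurryFin (P B')) := by
  have : (pull M).comp (∑ B', c B' • (P B').comp M) =
      ∑ B', c B' • (pull M).comp ((P B').comp M) := by
    ext1 x
    simp
  rw [this, alternatize_sum]
  simp only [alternatize_smul, pull_alternatize]

/-- Transformation of `d_{C'}` for form-valued functions of `q` alone. -/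
lemma exists_hasComplexDeriv_twist_act (hq : J1 h q ≠ 0) (e : ℕ) {f : Hn n → Lam n τ}
    (hf : DifferentiableAt ℝ f (act h q)) :
    ∃ Q, HasComplexDeriv (twist h e fun p => f (act h p)) Q q ∧
      ∀ C', alternatizeUncurryFin (Q C') =
        (kMat h q).det ^ e • (∑ B', kMat h q C' B' • pull (jMap h q) (dForm B' f (act h q)) +
          ((τ : ℂ) - e) • extMul n τ (beta h q C') (pull (jMap h q) (f (act h q)))) := by
  obtain ⟨Q, hQ, hQ'⟩ := exists_hasComplexDeriv_twist hq e
    (hasComplexDeriv_comp_act hq (HasComplexDeriv.of_hasFDerivAt hf.hasFDerivAt))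
  refine ⟨Q, hQ, fun C' => ?_⟩
  rw [hQ', alternatize_pull_sum_comp]
  rfl

lemma hasComplexDeriv_comp_act_pair {E : Type*} [NormedAddCommGroup E] [NormedSpace ℂ E]
    [NormedSpace ℝ E] [IsScalarTower ℝ ℂ E] {f : Hn n → (Fin 2 → ℂ) → E} {u : Hn n → Fin 2 → ℂ}
    {U : Fin 2 → Cn n →L[ℂ] Fin 2 → ℂ} (hq : J1 h q ≠ 0) (hu : HasComplexDeriv u U q)
    (hf : DifferentiableAt ℝ (Function.uncurry f) (act h q, u q))
    (hf' : DifferentiableAt ℂ (f (act h q)) (u q)) :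
    HasComplexDeriv (fun p => f (act h p) (u p))
      (fun C' => ∑ B', kMat h q C' B' •
          (complexPart B' (fderiv ℝ (fun p => f p (u q)) (act h q))).comp (jMap h q) +
        (fderiv ℂ (f (act h q)) (u q)).comp (U C')) q := by
  obtain ⟨Lφ, hLφ, hφ⟩ := exists_hasFDerivAt_act hq
  obtain ⟨Lu, hLu, hU⟩ := hu
  have h1 : HasFDerivAt (fun p => f p (u q)) ((fderiv ℝ (Function.uncurry f) (act h q, u q)).comp
      (ContinuousLinearMap.inl ℝ (Hn n) (Fin 2 → ℂ))) (act h q) :=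
    HasFDerivAt.comp (act h q) (g := Function.uncurry f) hf.hasFDerivAt
      (hasFDerivAt_prodMk_left (𝕜 := ℝ) (act h q) (u q))
  have h2 : HasFDerivAt (f (act h q)) ((fderiv ℝ (Function.uncurry f) (act h q, u q)).comp
      (ContinuousLinearMap.inr ℝ (Hn n) (Fin 2 → ℂ))) (u q) :=
    HasFDerivAt.comp (u q) (g := Function.uncurry f) hf.hasFDerivAt
      (hasFDerivAt_prodMk_right (𝕜 := ℝ) (act h q) (u q))
  -- The `s`-part of the joint real derivative is thereby complex linear, as composition with the
  -- complex maps `U` requires.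
  have h3 := h2.unique (hf'.hasFDerivAt.restrictScalars ℝ)
  refine ⟨_, HasFDerivAt.comp q (g := Function.uncurry f) hf.hasFDerivAt (hLφ.prodMk hLu),
    fun v => ?_⟩
  have h4 : fderiv ℝ (Function.uncurry f) (act h q, u q) (Lφ v, Lu v) =
      fderiv ℝ (fun p => f p (u q)) (act h q) (Lφ v) +
        fderiv ℂ (f (act h q)) (u q) (Lu v) := by
    have h5 := congrArg (fun T => T (Lu v)) h3
    simp only [ContinuousLinearMap.comp_apply, ContinuousLinearMap.inr_apply,
      ContinuousLinearMap.coe_restrictScalars'] at h5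
    rw [h1.fderiv, ← h5]
    simp only [ContinuousLinearMap.comp_apply, ContinuousLinearMap.inl_apply]
    rw [← _root_.map_add]
    simp
  simp only [ContinuousLinearMap.comp_apply, ContinuousLinearMap.prod_apply]
  rw [h4, hU, apply_eq_sum_complexPart (fderiv ℝ (fun p => f p (u q)) (act h q))]
  simp only [col_deriv_act hφ, Fin.sum_univ_two, map_add, map_smul, _root_.add_apply,
    _root_.smul_apply, ContinuousLinearMap.comp_apply]
  abel

/-- Transformation of `d_{C'}` for functions of `q` and `s`. -/
lemma dForm_twist_pair {f : SuperFun n τ} {u : Hn n → Fin 2 → ℂ}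
    {U : Fin 2 → Cn n →L[ℂ] Fin 2 → ℂ} (e : ℕ) (hq : J1 h q ≠ 0) (hu : HasComplexDeriv u U q)
    (hf : DifferentiableAt ℝ (Function.uncurry f) (act h q, u q))
    (hf' : DifferentiableAt ℂ (f (act h q)) (u q)) (C' : Fin 2) :
    dForm C' (twist h e fun p => f (act h p) (u p)) q =
      (kMat h q).det ^ e •
        (∑ B', kMat h q C' B' • pull (jMap h q) (dOp B' f (act h q) (u q)) +
          alternatizeUncurryFin ((pull (jMap h q)).comp
            ((fderiv ℂ (f (act h q)) (u q)).comp (U C'))) +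
          ((τ : ℂ) - e) • extMul n τ (beta h q C') (pull (jMap h q) (f (act h q) (u q)))) := by
  obtain ⟨Q, hQ, hQ'⟩ := exists_hasComplexDeriv_twist hq e
    (hasComplexDeriv_comp_act_pair hq hu hf hf')
  rw [hQ.dForm_eq, hQ', ContinuousLinearMap.comp_add,
    ContinuousAlternatingMap.alternatizeUncurryFin_add, alternatize_pull_sum_comp]
  simp only [dOp_eq_dForm]
  rfl

/-! ### The second order operator -/

lemma sum_comp_col_injective {E : Type*} [NormedAddCommGroup E] [NormedSpace ℂ E]
    [NormedSpace ℝ E] [IsScalarTower ℝ ℂ E] {P Q : Fin 2 → Cn n →L[ℂ] E}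
    (hPQ : ∀ v : Hn n, ∑ A', P A' (col A' v) = ∑ A', Q A' (col A' v)) : P = Q := by
  let L : Hn n →L[ℝ] E := ∑ A', ((P A').restrictScalars ℝ).comp (col A')
  have hL (v : Hn n) : L v = ∑ A', P A' (col A' v) := by simp [L]
  ext1 A'
  rw [← eq_complexPart_of_forall hL A',
    eq_complexPart_of_forall (fun v => (hL v).trans (hPQ v)) A']

section Second

variable {E : Type*} [NormedAddCommGroup E] [NormedSpace ℝ E]

lemma hasFDerivAt_fderiv_apply {f : Hn n → E} {D : Hn n →L[ℝ] Hn n →L[ℝ] E}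
    (hD : HasFDerivAt (fderiv ℝ f) D q) (v : Hn n) :
    HasFDerivAt (fun p => fderiv ℝ f p v) (D.flip v) q :=
  (ContinuousLinearMap.apply ℝ E v).hasFDerivAt.comp q hD

variable [NormedSpace ℂ E] [IsScalarTower ℝ ℂ E]

lemma exists_hasFDerivAt_complexCoeff_fderiv {f : Hn n → E} {D : Hn n →L[ℝ] Hn n →L[ℝ] E}
    (hD : HasFDerivAt (fderiv ℝ f) D q) (A : Fin n × Fin 2) (C' : Fin 2) :
    ∃ L : Hn n →L[ℝ] E, HasFDerivAt (fun p => complexCoeff (fderiv ℝ f p) A C') L q ∧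
      ∀ v, L v = complexCoeff (D v) A C' := by
  obtain ⟨l, α⟩ := A
  have h0 := hasFDerivAt_fderiv_apply hD (Pi.single l 1)
  have hI := hasFDerivAt_fderiv_apply hD (Pi.single l unitI)
  have hJ := hasFDerivAt_fderiv_apply hD (Pi.single l unitJ)
  have hK := hasFDerivAt_fderiv_apply hD (Pi.single l unitK)
  fin_cases α <;> fin_cases C'
  · exact ⟨_, (h0.add (hI.const_smul Complex.I)).const_smul (1 / 2 : ℂ), fun v => rfl⟩
  · exact ⟨_, (hJ.neg.sub (hK.const_smul Complex.I)).const_smul (1 / 2 : ℂ), fun v => rfl⟩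
  · exact ⟨_, (hJ.sub (hK.const_smul Complex.I)).const_smul (1 / 2 : ℂ), fun v => rfl⟩
  · exact ⟨_, (h0.sub (hI.const_smul Complex.I)).const_smul (1 / 2 : ℂ), fun v => rfl⟩

lemma exists_hasFDerivAt_complexPart_fderiv {f : Hn n → E} {D : Hn n →L[ℝ] Hn n →L[ℝ] E}
    (hD : HasFDerivAt (fderiv ℝ f) D q) (C' : Fin 2) :
    ∃ L : Hn n →L[ℝ] Cn n →L[ℂ] E, HasFDerivAt (fun p => complexPart C' (fderiv ℝ f p)) L q ∧
      ∀ v, L v = complexPart C' (D v) := by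
  choose L hL hL' using fun A => exists_hasFDerivAt_complexCoeff_fderiv hD A C'
  let T (A : Fin n × Fin 2) : E →L[ℂ] Cn n →L[ℂ] E := ContinuousLinearMap.smulRightL ℂ (Cn n) E
    (ContinuousLinearMap.proj (R := ℂ) (φ := fun _ : Fin n × Fin 2 => ℂ) A)
  refine ⟨_, HasFDerivAt.fun_sum (u := Finset.univ) fun A _ =>
    ((T A).restrictScalars ℝ).hasFDerivAt.comp q (hL A), fun v => ?_⟩
  simp only [_root_.sum_apply, ContinuousLinearMap.comp_apply, hL']
  rfl

/-- Symmetry of the complexified second derivative. -/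
lemma complexPart_symm {D : Hn n →L[ℝ] Hn n →L[ℝ] E} (hD : ∀ v w, D v w = D w v)
    {L : Fin 2 → Hn n →L[ℝ] Cn n →L[ℂ] E} (hL : ∀ C' v, L C' v = complexPart C' (D v))
    (B' C' : Fin 2) (x y : Cn n) :
    complexPart B' (L C') x y = complexPart C' (L B') y x := by
  let Q (B' C' : Fin 2) : Cn n →L[ℂ] Cn n →L[ℂ] E := complexPart B' (L C')
  have hDQ (v w : Hn n) : D v w = ∑ C', ∑ B', Q B' C' (col B' v) (col C' w) := by
    rw [apply_eq_sum_complexPart (D v) w]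
    refine Finset.sum_congr rfl fun C' _ => ?_
    rw [← hL, apply_eq_sum_complexPart (L C') v, _root_.sum_apply]
  -- Uniqueness of the splitting is used once in each real variable: first in `v` for fixed `w`,
  -- then in `w` for a fixed complex vector.
  have h1 (w : Hn n) : (fun B' => ∑ C', (Q B' C').flip (col C' w)) =
      fun B' => ∑ C', Q C' B' (col C' w) := by
    refine sum_comp_col_injective fun v => ?_
    simp only [_root_.sum_apply, ContinuousLinearMap.flip_apply]
    rw [← hDQ w v, hD w v, hDQ v w, Finset.sum_comm]
  have h2 (B' : Fin 2) (x : Cn n) : (fun C' => Q B' C' x) = fun C' => (Q C' B').flip x := by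
    refine sum_comp_col_injective fun w => ?_
    simpa using congrArg (fun T => T x) (congrFun (h1 w) B')
  exact congrArg (fun T => T y) (congrFun (h2 B' x) C')

end Second

lemma dForm_hasComplexDeriv {f : Hn n → Lam n τ} {L : Hn n →L[ℝ] Cn n →L[ℂ] Lam n τ}
    {C' : Fin 2} (hL : HasFDerivAt (fun p => complexPart C' (fderiv ℝ f p)) L q) :
    HasComplexDeriv (dForm C' f) (fun B' => (alternatizeUncurryFinCLM ℂ (Cn n) ℂ).comp
      (complexPart (E := Cn n →L[ℂ] Lam n τ) B' L)) q :=
  HasComplexDeriv.clm (f := fun p => complexPart C' (fderiv ℝ f p))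
    (alternatizeUncurryFinCLM ℂ (Cn n) ℂ) (HasComplexDeriv.of_hasFDerivAt hL)

lemma differentiableAt_fderiv_of_contDiffAt_two {f : Hn n → Lam n τ} (hf : ContDiffAt ℝ 2 f q) :
    DifferentiableAt ℝ (fderiv ℝ f) q :=
  (hf.fderiv_right (m := 1) (by norm_num)).differentiableAt (by norm_num)

lemma differentiableAt_dForm {f : Hn n → Lam n τ} (hf : ContDiffAt ℝ 2 f q) (C' : Fin 2) :
    DifferentiableAt ℝ (dForm C' f) q := by
  obtain ⟨L, hL, -⟩ := exists_hasFDerivAt_complexPart_fderiv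
    (differentiableAt_fderiv_of_contDiffAt_two hf).hasFDerivAt C'
  exact (dForm_hasComplexDeriv hL).differentiableAt

lemma alternatize_alternatize_swap {S T : Cn n →L[ℂ] Cn n →L[ℂ] Lam n τ}
    (hST : ∀ x y, S x y = T y x) :
    alternatizeUncurryFin ((alternatizeUncurryFinCLM ℂ (Cn n) ℂ).comp S) =
      -alternatizeUncurryFin ((alternatizeUncurryFinCLM ℂ (Cn n) ℂ).comp T) := by
  ext v
  rw [ContinuousAlternatingMap.neg_apply]
  simp only [ContinuousAlternatingMap.alternatizeUncurryFin_alternatizeUncurryFinCLM_comp_apply,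
    hST, ← Finset.sum_neg_distrib, ← smul_neg, neg_sub]

/-- The relation `d_{B'} d_{C'} = -d_{C'} d_{B'}`: symmetry of second derivatives exchanges primed
indices together with the vector arguments, and alternatization gives the sign. -/
lemma dForm_dForm_swap {f : Hn n → Lam n τ} (hf : ContDiffAt ℝ 2 f q) (B' C' : Fin 2) :
    dForm B' (dForm C' f) q = -dForm C' (dForm B' f) q := by
  have hs : IsSymmSndFDerivAt ℝ f q := hf.isSymmSndFDerivAt (by simp)
  choose L hL hL' using exists_hasFDerivAt_complexPart_fderiv
    (differentiableAt_fderiv_of_contDiffAt_two hf).hasFDerivAt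
  rw [(dForm_hasComplexDeriv (hL C')).dForm_eq, (dForm_hasComplexDeriv (hL B')).dForm_eq]
  exact alternatize_alternatize_swap fun x y =>
    complexPart_symm (fun v w => hs.eq v w) hL' _ _ _ _

/-- Transformation of `d_{0'} d_{1'}`. -/
lemma dForm_dForm_twist {D : Set (Hn n)} (hD : IsOpen D) {f : Hn n → Lam n τ}
    (hf : ContDiffOn ℝ 2 f D) {U : Set (Hn n)} (hU : IsOpen U)
    (hUD : ∀ p ∈ U, J1 h p ≠ 0 ∧ act h p ∈ D) (hq : q ∈ U) :
    dForm 0 (dForm 1 (twist h (τ + 1) fun p => f (act h p))) q =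
      (kMat h q).det ^ (τ + 2) • pull (jMap h q) (dForm 0 (dForm 1 f) (act h q)) := by
  have hfd {p : Hn n} (hp : p ∈ U) : ContDiffAt ℝ 2 f (act h p) :=
    hf.contDiffAt (hD.mem_nhds (hUD p hp).2)
  have hdf {p : Hn n} (hp : p ∈ U) (C' : Fin 2) : DifferentiableAt ℝ (dForm C' f) (act h p) :=
    differentiableAt_dForm (hfd hp) C'
  let G : Hn n → Lam n τ := twist h (τ + 1) fun p => f (act h p)
  let H (B' : Fin 2) : Hn n → Lam n (τ + 1) := twist h (τ + 1) fun p => dForm B' f (act h p)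
  have hG (p : Hn n) (hp : p ∈ U) : ∃ Q, HasComplexDeriv G Q p ∧ ∀ C',
      alternatizeUncurryFin (Q C') =
        ∑ B', kMat h p C' B' • H B' p - extMul n τ (beta h p C') (G p) := by
    obtain ⟨Q, hQ, hQ'⟩ := exists_hasComplexDeriv_twist_act (hUD p hp).1 (τ + 1)
      ((hfd hp).differentiableAt (by norm_num))
    refine ⟨Q, hQ, fun C' => ?_⟩
    rw [hQ']
    simp only [G, H, twist, map_smul, Nat.cast_add, Nat.cast_one]
    simp only [Fin.sum_univ_two]
    module
  -- Here the form degree is `τ + 1`, equal to the exponent, so the error coefficient is zero.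
  have hH (B' : Fin 2) : ∃ Q, HasComplexDeriv (H B') Q q ∧ ∀ C',
      alternatizeUncurryFin (Q C') = (kMat h q).det ^ (τ + 1) • ∑ E', kMat h q C' E' •
        pull (jMap h q) (dForm E' (dForm B' f) (act h q)) := by
    obtain ⟨Q, hQ, hQ'⟩ := exists_hasComplexDeriv_twist_act (hUD q hq).1 (τ + 1) (hdf hq B')
    refine ⟨Q, hQ, fun C' => ?_⟩
    rw [hQ']
    simp
  -- The first-order formula is needed on a neighbourhood of `q`, since it is differentiated again.
  have hG1 : dForm 1 G =ᶠ[𝓝 q] fun p =>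
      ∑ B', kMat h p 1 B' • H B' p + -extMul n τ (beta h p 1) (G p) := by
    filter_upwards [hU.mem_nhds hq] with p hp
    obtain ⟨Q, hQ, hQ'⟩ := hG p hp
    rw [hQ.dForm_eq, hQ', sub_eq_add_neg]
  choose QH hQH hQH' using hH
  obtain ⟨QG, hQG, hQG'⟩ := hG q hq
  have hJ := (hUD q hq).1
  have key := (HasComplexDeriv.sum Finset.univ fun B' _ =>
      (hasComplexDeriv_kMat hJ 1 B').smul (hQH B')).add
    (HasComplexDeriv.bilin (extMul n τ) (hasComplexDeriv_beta hJ 1) hQG).neg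
  have hs : ((extMul n τ).flip (G q)).comp (-((beta h q 1).smulRight (beta h q 0))) =
      -((beta h q 1).smulRight (extMul n τ (beta h q 0) (G q))) := by
    ext1 x
    simp
  have hk (B' : Fin 2) : (-(kMat h q 0 B' • beta h q 1)).smulRight (H B' q) =
      (-kMat h q 0 B') • (beta h q 1).smulRight (H B' q) := by
    ext1 x
    simp
    module
  rw [(key.congr_of_eventuallyEq hG1).dForm_eq]
  rw [hs]
  -- The derivative of `k_{1B'}` gives `-k_{0B'} β_1 ∧ H_{B'}`, and `d_0` of `-β_1 ∧ G` gives the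
  -- opposite; the two terms `β_1 ∧ β_0 ∧ G` also cancel each other.
  simp only [hk, ContinuousAlternatingMap.alternatizeUncurryFin_add, alternatize_sum,
    alternatize_neg, alternatize_smul, ← extMul_apply, alternatize_extMul_comp, hQG', hQH']
  -- Only `d_{0'} d_{1'}` survives in `∑ k_{1B'} k_{0E'} d_{E'} d_{B'} f`, with coefficient `det k`.
  have h00 : dForm 0 (dForm 0 f) (act h q) = 0 := by
    ext v
    exact self_eq_neg.mp (DFunLike.congr_fun (dForm_dForm_swap (hfd hq) 0 0) v)
  have h11 : dForm 1 (dForm 1 f) (act h q) = 0 := by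
    ext v
    exact self_eq_neg.mp (DFunLike.congr_fun (dForm_dForm_swap (hfd hq) 1 1) v)
  have h10 := dForm_dForm_swap (hfd hq) 1 0
  simp only [Fin.sum_univ_two, h00, h11, h10, map_zero, map_neg, map_sub, map_add, map_smul,
    Matrix.det_fin_two]
  module

end

noncomputable section

variable {n : ℕ} {h : SLH n} {q : Hn n} {τ : ℕ}

/-! ### The first order operators -/

lemma sum_dUp_eq (F : Fin 2 → SuperFun n τ) (s : Fin 2 → ℂ) :
    ∑ A', dUp A' (F A') q s =
      fderiv ℂ (F 0 q) s (Pi.single 1 1) - fderiv ℂ (F 1 q) s (Pi.single 0 1) := by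
  simp [dUp, eps, Fin.sum_univ_two]
  module

lemma sum_mulSUp_eq (F : Fin 2 → SuperFun n τ) (s : Fin 2 → ℂ) :
    ∑ A', mulSUp A' (F A') q s = s 1 • F 0 q s - s 0 • F 1 q s := by
  simp [mulSUp, eps, Fin.sum_univ_two]
  module

section Cancel

variable {E F : Type*} [NormedAddCommGroup E] [NormedSpace ℂ E] [NormedAddCommGroup F]
  [NormedSpace ℂ F]

/-- The terms subtracted from `G C'` form the `C'`-th partial derivative of the single function `t ↦
∑ t_{B'} X_{B'} (ψ t)`, so equality of mixed partials removes them. -/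
lemma fderiv_sub_fderiv_cancel {ψ : (Fin 2 → ℂ) → E} (hψ : ContDiff ℂ 2 ψ) (X : Fin 2 → E →L[ℂ] F)
    {G : Fin 2 → (Fin 2 → ℂ) → F} (s : Fin 2 → ℂ) (hG : ∀ C', DifferentiableAt ℂ (G C') s)
    {W : Fin 2 → (Fin 2 → ℂ) → F} (hW : ∀ C' t, W C' t = G C' t - X C' (ψ t) -
      ∑ B', t B' • X B' (fderiv ℂ ψ t (Pi.single C' 1))) :
    fderiv ℂ (W 0) s (Pi.single 1 1) - fderiv ℂ (W 1) s (Pi.single 0 1) =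
      fderiv ℂ (G 0) s (Pi.single 1 1) - fderiv ℂ (G 1) s (Pi.single 0 1) := by
  have h1 : HasFDerivAt ψ (fderiv ℂ ψ s) s := (hψ.differentiable (by norm_num) s).hasFDerivAt
  have h2 : HasFDerivAt (fderiv ℂ ψ) (fderiv ℂ (fderiv ℂ ψ) s) s :=
    ((hψ.fderiv_right (m := 1) (by norm_num)).differentiable (by norm_num) s).hasFDerivAt
  have hsymm : IsSymmSndFDerivAt ℂ ψ s := hψ.contDiffAt.isSymmSndFDerivAt (by simp)
  have h3' (v : Fin 2 → ℂ) : HasFDerivAt (fun t => fderiv ℂ ψ t v)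
      ((fderiv ℂ (fderiv ℂ ψ) s).flip v) s :=
    (ContinuousLinearMap.apply ℂ E v).hasFDerivAt.comp s h2
  have h3 (C' : Fin 2) := h3' (Pi.single C' 1)
  have h4 (C' : Fin 2) : HasFDerivAt (W C') _ s :=
    (((hG C').hasFDerivAt.sub ((X C').hasFDerivAt.comp s h1)).sub
      (HasFDerivAt.fun_sum (u := Finset.univ) fun B' _ =>
        (hasFDerivAt_apply (𝕜 := ℂ) B' s).smul ((X B').hasFDerivAt.comp s (h3 C')))).congr_of_eventuallyEq
      (Filter.Eventually.of_forall fun t => by rw [hW]; rfl)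
  have hs := hsymm.eq (Pi.single 0 1) (Pi.single 1 1)
  rw [(h4 0).fderiv, (h4 1).fderiv]
  simp [hs]
  abel

end Cancel

/-- Substitution in the variables `s^{A'}` induced by `J₁⁻¹`. -/
def kAct (h : SLH n) (q : Hn n) : (Fin 2 → ℂ) →L[ℂ] (Fin 2 → ℂ) :=
  LinearMap.toContinuousLinearMap (Matrix.toLin' (kMat h q).transpose)

lemma kAct_apply (h : SLH n) (q : Hn n) (s : Fin 2 → ℂ) (A' : Fin 2) :
    kAct h q s A' = ∑ B', kMat h q B' A' * s B' := by
  simp [kAct, Matrix.mulVec, dotProduct]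

lemma kAct_single (h : SLH n) (q : Hn n) (C' : Fin 2) :
    kAct h q (Pi.single C' 1) = fun A' => kMat h q C' A' := by
  ext A'
  simp [kAct_apply, Pi.single_apply]

lemma hasComplexDeriv_kAct (hq : J1 h q ≠ 0) (s : Fin 2 → ℂ) :
    HasComplexDeriv (fun p => kAct h p s)
      (fun C' => -((∑ B', s B' • beta h q B').smulRight (kAct h q (Pi.single C' 1)))) q := by
  have h1 (A' : Fin 2) := HasComplexDeriv.sum Finset.univ (f := fun B' p => kMat h p B' A' • s B')
    fun B' _ => (hasComplexDeriv_kMat hq B' A').smul (HasComplexDeriv.const (s B') q)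
  refine ((HasComplexDeriv.pi (f := fun p => kAct h p s) fun A' =>
    (h1 A').congr_of_eventuallyEq (Filter.Eventually.of_forall fun p => ?_))).congr_deriv
      fun C' => ?_
  · simp [kAct_apply]
  · ext1 w
    ext A'
    simp [kAct_single]
    ring

lemma hasFDerivAt_kAct_comp {E : Type*} [NormedAddCommGroup E] [NormedSpace ℂ E]
    {p : (Fin 2 → ℂ) → E} {s : Fin 2 → ℂ} (hp : DifferentiableAt ℂ p (kAct h q s)) :
    HasFDerivAt (fun t => p (kAct h q t)) ((fderiv ℂ p (kAct h q s)).comp (kAct h q)) s :=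
  hp.hasFDerivAt.comp s (kAct h q).hasFDerivAt

/-- Transformation of `∂^{A'} d_{A'}`. -/
lemma sum_dUp_dOp_twist (hq : J1 h q ≠ 0) {f : SuperFun n τ}
    (hf : ∀ s, DifferentiableAt ℝ (Function.uncurry f) (act h q, s))
    (hf2 : ContDiff ℂ 2 (f (act h q))) (hd : ∀ B', Differentiable ℂ (dOp B' f (act h q)))
    (s : Fin 2 → ℂ) :
    ∑ A', dUp A' (dOp A' fun p s => twist h (τ + 1) (fun p => f (act h p) (kAct h p s)) p) q s =
      (kMat h q).det ^ (τ + 2) •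
        pull (jMap h q) (∑ A', dUp A' (dOp A' f) (act h q) (kAct h q s)) := by
  have hfd : Differentiable ℂ (f (act h q)) := hf2.differentiable (by norm_num)
  let ψ : (Fin 2 → ℂ) → Lam n τ := fun t => pull (jMap h q) (f (act h q) (kAct h q t))
  have hψ : ContDiff ℂ 2 ψ :=
    (pull (jMap h q)).contDiff.comp (hf2.comp (kAct h q).contDiff)
  have hψ' (t : Fin 2 → ℂ) : HasFDerivAt ψ ((pull (jMap h q)).comp
      ((fderiv ℂ (f (act h q)) (kAct h q t)).comp (kAct h q))) t :=
    (pull (jMap h q)).hasFDerivAt.comp t (hasFDerivAt_kAct_comp (hfd _))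
  let g (B' : Fin 2) (t : Fin 2 → ℂ) : Lam n (τ + 1) :=
    pull (jMap h q) (dOp B' f (act h q) (kAct h q t))
  have hg (B' : Fin 2) : HasFDerivAt (g B') ((pull (jMap h q)).comp
      ((fderiv ℂ (dOp B' f (act h q)) (kAct h q s)).comp (kAct h q))) s :=
    (pull (jMap h q)).hasFDerivAt.comp s (hasFDerivAt_kAct_comp (hd B' _))
  let c := (kMat h q).det ^ (τ + 1)
  let G (C' : Fin 2) (t : Fin 2 → ℂ) : Lam n (τ + 1) := ∑ B', (c * kMat h q C' B') • g B' t
  have hG (C' : Fin 2) : HasFDerivAt (G C') _ s :=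
    HasFDerivAt.fun_sum (u := Finset.univ) fun B' _ => (hg B').const_smul (c * kMat h q C' B')
  -- The exponent exceeds the degree by one, whence the single term `-β_{C'} ∧ ψ`; the last sum
  -- comes from the `q`-dependence of the substitution `kAct`.
  have hW (C' : Fin 2) (t : Fin 2 → ℂ) :
      dOp C' (fun p s => twist h (τ + 1) (fun p => f (act h p) (kAct h p s)) p) q t =
        G C' t - (c • extMul n τ (beta h q C')) (ψ t) -
          ∑ B', t B' • (c • extMul n τ (beta h q B')) (fderiv ℂ ψ t (Pi.single C' 1)) := by
    have hcomp : (pull (jMap h q)).comp ((fderiv ℂ (f (act h q)) (kAct h q t)).comp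
        (-((∑ B', t B' • beta h q B').smulRight (kAct h q (Pi.single C' 1))))) =
        -((∑ B', t B' • beta h q B').smulRight (fderiv ℂ ψ t (Pi.single C' 1))) := by
      rw [(hψ' t).fderiv]
      ext1 w
      simp only [ContinuousLinearMap.comp_apply, _root_.neg_apply,
        ContinuousLinearMap.smulRight_apply, map_neg, map_smul]
    rw [dOp_eq_dForm]
    refine (dForm_twist_pair (τ + 1) hq (hasComplexDeriv_kAct hq t) (hf _) (hfd _) C').trans ?_
    rw [hcomp, alternatize_neg, ← extMul_apply]
    simp only [Fin.sum_univ_two, map_add, map_smul, _root_.add_apply, _root_.smul_apply, G, c, g, ψ,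
      Nat.cast_add, Nat.cast_one]
    module
  rw [sum_dUp_eq, sum_dUp_eq, fderiv_sub_fderiv_cancel hψ (fun B' => c • extMul n τ (beta h q B'))
    s (fun C' => (hG C').differentiableAt) hW, (hG 0).fderiv, (hG 1).fderiv]
  have hk (C' : Fin 2) : kAct h q (Pi.single C' 1) =
      kMat h q C' 0 • Pi.single 0 1 + kMat h q C' 1 • Pi.single 1 1 := by
    rw [kAct_single]
    ext A'
    fin_cases A' <;> simp
  simp only [Fin.sum_univ_two, _root_.add_apply, _root_.smul_apply, ContinuousLinearMap.comp_apply,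
    hk, map_add, map_smul, map_sub, c, pow_succ, Matrix.det_fin_two]
  module

/-- Substitution in the variables `S_{A'}` induced by the transpose of `J₁`. -/
def jAct (h : SLH n) (q : Hn n) (s : Fin 2 → ℂ) : Fin 2 → ℂ :=
  fun A' => ∑ B', tau (J1 h q) A' B' * s B'

lemma hasComplexDeriv_jAct (s : Fin 2 → ℂ) :
    HasComplexDeriv (fun p => jAct h p s)
      (fun C' => s C' • ContinuousLinearMap.pi fun A' => bCov h A') q := by
  have h1 (A' B' : Fin 2) : HasComplexDeriv (fun p => tau (J1 h p) A' B')
      (fun C' => (if C' = B' then (1 : ℂ) else 0) • bCov h A') q := by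
    refine ⟨_, (tauEntry A' B').hasFDerivAt.comp q (hasFDerivAt_J1 h q), fun v => ?_⟩
    rw [ContinuousLinearMap.comp_apply, tauEntry_apply, bLin_apply, ← bCov_col]
    simp only [_root_.smul_apply, smul_eq_mul]
    simp
  have h2 (A' : Fin 2) := HasComplexDeriv.sum Finset.univ
    (f := fun B' p => tau (J1 h p) A' B' • s B')
    fun B' _ => (h1 A' B').smul (HasComplexDeriv.const (s B') q)
  refine (HasComplexDeriv.pi (f := fun p => jAct h p s) h2).congr_deriv fun C' => ?_
  ext1 w
  ext A'
  simp only [ContinuousLinearMap.pi_apply, _root_.sum_apply, _root_.add_apply,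
    ContinuousLinearMap.smulRight_apply, _root_.smul_apply, smul_eq_mul, Pi.smul_apply]
  simp [mul_comm]

lemma kMat_mul_jAct (hq : J1 h q ≠ 0) (s : Fin 2 → ℂ) (A' : Fin 2) :
    s A' = ∑ B', kMat h q A' B' * jAct h q s B' := by
  have h1 : kMat h q * tau (J1 h q) = 1 := by
    rw [kMat, ← tau_mul, inv_mul_cancel₀ hq, tau_one]
  have h2 := congrFun (congrArg (fun T => Matrix.mulVec T s) h1) A'
  simp only [← Matrix.mulVec_mulVec, Matrix.one_mulVec] at h2
  rw [← h2]
  rfl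

/-- Transformation of `S^{A'} d_{A'}`. -/
lemma sum_mulSUp_dOp_twist (hq : J1 h q ≠ 0) {f : SuperFun n τ}
    (hf : ∀ s, DifferentiableAt ℝ (Function.uncurry f) (act h q, s))
    (hf' : Differentiable ℂ (f (act h q))) (s : Fin 2 → ℂ) :
    ∑ A', mulSUp A' (dOp A' fun p s => twist h τ (fun p => f (act h p) (jAct h p s)) p) q s =
      (kMat h q).det ^ (τ + 1) •
        pull (jMap h q) (∑ A', mulSUp A' (dOp A' f) (act h q) (jAct h q s)) := by
  -- The exponent equals the degree, so no `β`-term occurs. The derivative of `J₁` is the constant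
  -- `b`, which leaves `s C'` times a form independent of `C'`.
  have hW (C' : Fin 2) :
      dOp C' (fun p s => twist h τ (fun p => f (act h p) (jAct h p s)) p) q s =
        (kMat h q).det ^ τ • (∑ B', kMat h q C' B' •
          pull (jMap h q) (dOp B' f (act h q) (jAct h q s)) +
        s C' • alternatizeUncurryFin ((pull (jMap h q)).comp
          ((fderiv ℂ (f (act h q)) (jAct h q s)).comp
            (ContinuousLinearMap.pi fun A' => bCov h A')))) := by
    rw [dOp_eq_dForm]
    refine (dForm_twist_pair τ hq (hasComplexDeriv_jAct s) (hf _) (hf' _) C').trans ?_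
    have hs : (pull (jMap h q)).comp ((fderiv ℂ (f (act h q)) (jAct h q s)).comp
        (s C' • ContinuousLinearMap.pi fun A' => bCov h A')) =
        s C' • (pull (jMap h q)).comp ((fderiv ℂ (f (act h q)) (jAct h q s)).comp
          (ContinuousLinearMap.pi fun A' => bCov h A')) := by
      ext1 w
      simp
    rw [hs, alternatize_smul]
    module
  rw [sum_mulSUp_eq, sum_mulSUp_eq, hW, hW]
  have h0 := kMat_mul_jAct hq s 0
  have h1 := kMat_mul_jAct hq s 1
  simp only [Fin.sum_univ_two] at h0 h1 ⊢
  simp only [map_sub, map_smul, pow_succ, Matrix.det_fin_two]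
  generalize jAct h q s = y at *
  -- Expressing `s` as `k` applied to `y = J₁ s` lets both indices of `k` be antisymmetrized into
  -- `det k`.
  rw [h0, h1]
  module

end

noncomputable section

variable {n : ℕ}

/-! ### Families of homogeneous polynomials with smooth coefficients -/

section Poly

variable {E : Type*} [NormedAddCommGroup E] [NormedSpace ℂ E] [NormedSpace ℝ E]

/-- On `D`, `f` is a homogeneous polynomial of degree `σ` in `s` with coefficients of class `C^r`. -/
def IsPolyFamily (σ : ℕ) (r : WithTop ℕ∞) (D : Set (Hn n)) (f : Hn n → (Fin 2 → ℂ) → E) : Prop :=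
  ∃ c : Fin (σ + 1) → Hn n → E, (∀ i, ContDiffOn ℝ r (c i) D) ∧
    ∀ q ∈ D, ∀ s, f q s = ∑ i : Fin (σ + 1), (s 0 ^ (i : ℕ) * s 1 ^ (σ - i)) • c i q

variable {σ : ℕ} {r : WithTop ℕ∞} {D : Set (Hn n)} {f g : Hn n → (Fin 2 → ℂ) → E}

lemma IsPolyFamily.congr (hf : IsPolyFamily σ r D f) (hg : ∀ q ∈ D, ∀ s, g q s = f q s) :
    IsPolyFamily σ r D g := by
  obtain ⟨c, hc, hfc⟩ := hf
  exact ⟨c, hc, fun q hq s => (hg q hq s).trans (hfc q hq s)⟩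

lemma IsPolyFamily.zero : IsPolyFamily σ r D (fun _ _ => (0 : E)) :=
  ⟨fun _ _ => 0, fun _ => contDiffOn_const, fun q _ s => by simp⟩

lemma IsPolyFamily.const {c : Hn n → E} (hc : ContDiffOn ℝ r c D) :
    IsPolyFamily 0 r D (fun q _ => c q) :=
  ⟨fun _ => c, fun _ => hc, fun q _ s => by simp⟩

lemma IsPolyFamily.add (hf : IsPolyFamily σ r D f) (hg : IsPolyFamily σ r D g) :
    IsPolyFamily σ r D (fun q s => f q s + g q s) := by
  obtain ⟨c, hc, hfc⟩ := hf
  obtain ⟨d, hd, hgd⟩ := hg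
  refine ⟨fun i q => c i q + d i q, fun i => (hc i).add (hd i), fun q hq s => ?_⟩
  simp only [hfc q hq, hgd q hq, smul_add, Finset.sum_add_distrib]

lemma IsPolyFamily.sum {ι : Type*} (t : Finset ι) {f : ι → Hn n → (Fin 2 → ℂ) → E}
    (hf : ∀ i ∈ t, IsPolyFamily σ r D (f i)) :
    IsPolyFamily σ r D (fun q s => ∑ i ∈ t, f i q s) := by
  classical
  induction t using Finset.induction_on with
  | empty => exact IsPolyFamily.zero
  | insert a t ha ih =>
    simp only [Finset.sum_insert ha]
    exact (hf a (by simp)).add (ih fun i hi => hf i (by simp [hi]))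

lemma IsPolyFamily.mul_coord (hf : IsPolyFamily σ r D f) (B' : Fin 2) :
    IsPolyFamily (σ + 1) r D (fun q s => s B' • f q s) := by
  obtain ⟨c, hc, hfc⟩ := hf
  fin_cases B'
  -- Coefficients are indexed by the power of `s 0`: multiplying by `s 0` shifts them up, while
  -- multiplying by `s 1` keeps them and adds a zero top coefficient.
  · refine ⟨Fin.cons (fun _ => 0) c, fun i => ?_, fun q hq s => ?_⟩
    · refine Fin.cases ?_ (fun i => ?_) i
      · exact contDiffOn_const
      · exact hc i
    · beta_reduce
      rw [Fin.sum_univ_succ, hfc q hq]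
      simp only [Fin.cons_zero, Fin.cons_succ, smul_zero, zero_add, Finset.smul_sum, smul_smul,
        Fin.val_succ, Nat.add_sub_add_right]
      exact Finset.sum_congr rfl fun i _ => by congr 1; simp only [Fin.zero_eta]; ring
  · refine ⟨Fin.snoc c (fun _ => 0), fun i => ?_, fun q hq s => ?_⟩
    · refine Fin.lastCases ?_ (fun i => ?_) i
      · simpa using contDiffOn_const
      · simpa using hc i
    · beta_reduce
      rw [Fin.sum_univ_castSucc, hfc q hq]
      simp only [Fin.snoc_castSucc, Fin.snoc_last, smul_zero, add_zero, Finset.smul_sum, smul_smul,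
        Fin.val_castSucc]
      refine Finset.sum_congr rfl fun i _ => ?_
      have hi : σ + 1 - (i : ℕ) = (σ - i) + 1 := by omega
      rw [hi, pow_succ]
      congr 1
      simp only [Fin.mk_one]
      ring

lemma IsPolyFamily.contDiff (hf : IsPolyFamily σ r D f) {q : Hn n} (hq : q ∈ D)
    {m : WithTop ℕ∞} : ContDiff ℂ m (f q) := by
  obtain ⟨c, hc, hfc⟩ := hf
  rw [show f q = _ from funext (hfc q hq)]
  fun_prop

variable [IsScalarTower ℝ ℂ E]

lemma IsPolyFamily.smul {a : Hn n → ℂ} (ha : ContDiffOn ℝ r a D) (hf : IsPolyFamily σ r D f) :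
    IsPolyFamily σ r D (fun q s => a q • f q s) := by
  obtain ⟨c, hc, hfc⟩ := hf
  refine ⟨fun i q => a q • c i q, fun i => ha.smul (hc i), fun q hq s => ?_⟩
  simp only [hfc q hq, Finset.smul_sum, smul_smul, mul_comm]

lemma IsPolyFamily.mul_linear {a : Fin 2 → Hn n → ℂ} (ha : ∀ B', ContDiffOn ℝ r (a B') D)
    (hf : IsPolyFamily σ r D f) :
    IsPolyFamily (σ + 1) r D (fun q s => (∑ B', a B' q * s B') • f q s) := by
  refine (IsPolyFamily.sum Finset.univ fun B' _ => (hf.smul (ha B')).mul_coord B').congr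
    fun q _ s => ?_
  simp only [Finset.sum_smul, smul_smul, mul_comm]

lemma IsPolyFamily.pow_linear {a : Fin 2 → Hn n → ℂ} (ha : ∀ B', ContDiffOn ℝ r (a B') D)
    (hf : IsPolyFamily σ r D f) (m : ℕ) :
    IsPolyFamily (m + σ) r D (fun q s => (∑ B', a B' q * s B') ^ m • f q s) := by
  induction m with
  | zero =>
    rw [zero_add]
    exact hf.congr fun q _ s => by simp
  | succ m ih =>
    rw [Nat.succ_add]
    exact (ih.mul_linear ha).congr fun q _ s => by rw [pow_succ', smul_smul]

lemma IsPolyFamily.linear_monomial {N : Fin 2 → Fin 2 → Hn n → ℂ}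
    (hN : ∀ A' B', ContDiffOn ℝ r (N A' B') D) {c : Hn n → E} (hc : ContDiffOn ℝ r c D) (a b : ℕ) :
    IsPolyFamily (a + b) r D (fun q s =>
      ((∑ B', N 0 B' q * s B') ^ a * (∑ B', N 1 B' q * s B') ^ b) • c q) :=
  (((IsPolyFamily.const hc).pow_linear (hN 1) b).pow_linear (hN 0) a).congr
    fun q _ s => by rw [smul_smul]

lemma IsPolyFamily.monomial {c : Hn n → E} (hc : ContDiffOn ℝ r c D) (a b : ℕ) :
    IsPolyFamily (a + b) r D (fun q s => (s 0 ^ a * s 1 ^ b) • c q) :=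
  (IsPolyFamily.linear_monomial (N := fun A' B' _ => if A' = B' then 1 else 0)
    (fun _ _ => contDiffOn_const) hc a b).congr fun q _ s => by simp

lemma IsPolyFamily.subst {U : Set (Hn n)} {φ : Hn n → Hn n} {N : Fin 2 → Fin 2 → Hn n → ℂ}
    (hf : IsPolyFamily σ r D f) (hφ : ContDiffOn ℝ r φ U) (hU : Set.MapsTo φ U D)
    (hN : ∀ A' B', ContDiffOn ℝ r (N A' B') U) {u : Hn n → (Fin 2 → ℂ) → Fin 2 → ℂ}
    (hu : ∀ q s A', u q s A' = ∑ B', N A' B' q * s B') :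
    IsPolyFamily σ r U (fun q s => f (φ q) (u q s)) := by
  obtain ⟨c, hc, hfc⟩ := hf
  refine (IsPolyFamily.sum Finset.univ (f := fun (i : Fin (σ + 1)) q s =>
    ((∑ B', N 0 B' q * s B') ^ (i : ℕ) * (∑ B', N 1 B' q * s B') ^ (σ - i)) • c i (φ q))
    fun i _ => ?_).congr fun q hq s => ?_
  · have h := IsPolyFamily.linear_monomial hN ((hc i).comp hφ hU) i (σ - i)
    rwa [Nat.add_sub_cancel' (Nat.lt_succ_iff.mp i.2)] at h
  · simp only [hfc _ (hU hq), hu]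

lemma IsPolyFamily.clm {F : Type*} [NormedAddCommGroup F] [NormedSpace ℂ F] [NormedSpace ℝ F]
    [IsScalarTower ℝ ℂ F] {T : Hn n → E →L[ℂ] F} (hT : ContDiffOn ℝ r T D)
    (hf : IsPolyFamily σ r D f) : IsPolyFamily σ r D (fun q s => T q (f q s)) := by
  obtain ⟨c, hc, hfc⟩ := hf
  refine ⟨fun i q => T q (c i q), fun i => ?_, fun q hq s => ?_⟩
  · exact ((ContinuousLinearMap.restrictScalarsL ℂ E F ℝ ℝ).contDiff.comp_contDiffOn hT).clm_apply
      (hc i)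
  · simp only [hfc q hq, map_sum, map_smul]

lemma IsPolyFamily.differentiableAt (hf : IsPolyFamily σ r D f) (hr : 1 ≤ r) (hD : IsOpen D)
    {q : Hn n} (hq : q ∈ D) (s : Fin 2 → ℂ) :
    DifferentiableAt ℝ (Function.uncurry f) (q, s) := by
  obtain ⟨c, hc, hfc⟩ := hf
  have h1 : DifferentiableAt ℝ (fun x : Hn n × (Fin 2 → ℂ) =>
      ∑ i : Fin (σ + 1), (x.2 0 ^ (i : ℕ) * x.2 1 ^ (σ - i)) • c i x.1) (q, s) := by
    refine DifferentiableAt.fun_sum fun i _ => DifferentiableAt.smul (by fun_prop) ?_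
    have h2 : DifferentiableAt ℝ (c i) q :=
      ((hc i).contDiffAt (hD.mem_nhds hq)).differentiableAt (by
        rintro rfl
        simp at hr)
    exact DifferentiableAt.comp (g := c i) (q, s) h2 differentiableAt_fst
  refine h1.congr_of_eventuallyEq ?_
  filter_upwards [(hD.prod isOpen_univ).mem_nhds (⟨hq, trivial⟩ : (q, s) ∈ D ×ˢ Set.univ)] with x hx
  exact hfc x.1 hx.1 x.2

lemma IsPolyFamily.fderiv_apply (hf : IsPolyFamily (σ + 1) r D f) (B' : Fin 2) :
    IsPolyFamily σ r D (fun q s => fderiv ℂ (f q) s (Pi.single B' 1)) := by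
  obtain ⟨c, hc, hfc⟩ := hf
  have hmono (a b : ℕ) (s : Fin 2 → ℂ) : HasFDerivAt (fun s : Fin 2 → ℂ => s 0 ^ a * s 1 ^ b)
      (s 0 ^ a • (((b : ℂ) * s 1 ^ (b - 1)) •
          ContinuousLinearMap.proj (R := ℂ) (φ := fun _ : Fin 2 => ℂ) 1) +
        s 1 ^ b • (((a : ℂ) * s 0 ^ (a - 1)) •
          ContinuousLinearMap.proj (R := ℂ) (φ := fun _ : Fin 2 => ℂ) 0)) s := by
    have h0 := (hasFDerivAt_apply (𝕜 := ℂ) (0 : Fin 2) s).pow a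
    have h1 := (hasFDerivAt_apply (𝕜 := ℂ) (1 : Fin 2) s).pow b
    refine (h0.mul h1).congr_fderiv ?_
    ext v
    simp
  have hfd (q : Hn n) (hq : q ∈ D) (s : Fin 2 → ℂ) : HasFDerivAt (f q) _ s :=
    (HasFDerivAt.fun_sum (u := Finset.univ) fun (i : Fin (σ + 1 + 1)) _ =>
      (hmono i (σ + 1 - i) s).smul_const (c i q)).congr_of_eventuallyEq
      (Filter.Eventually.of_forall fun t => hfc q hq t)
  refine IsPolyFamily.congr (f := fun q s => ∑ i : Fin (σ + 1 + 1), (s 0 ^ (i : ℕ) *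
      (((σ + 1 - i : ℕ) : ℂ) * s 1 ^ (σ + 1 - i - 1) * (Pi.single B' 1 : Fin 2 → ℂ) 1) +
      s 1 ^ (σ + 1 - i) * ((i : ℂ) * s 0 ^ ((i : ℕ) - 1) * (Pi.single B' 1 : Fin 2 → ℂ) 0)) • c i q)
    (IsPolyFamily.sum _ fun i _ => ?_) fun q hq s => ?_
  · have h1 : IsPolyFamily σ r D (fun q s => (s 0 ^ (i : ℕ) *
        (((σ + 1 - i : ℕ) : ℂ) * s 1 ^ (σ + 1 - i - 1) * (Pi.single B' 1 : Fin 2 → ℂ) 1)) •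
          c i q) := by
      rcases Nat.lt_or_ge i (σ + 1) with hi | hi
      · have h := (IsPolyFamily.monomial (hc i) i (σ + 1 - i - 1)).smul
          (contDiffOn_const (c := ((σ + 1 - i : ℕ) : ℂ) * (Pi.single B' 1 : Fin 2 → ℂ) 1))
        rw [show (i : ℕ) + (σ + 1 - i - 1) = σ by omega] at h
        refine h.congr fun q _ s => ?_
        rw [smul_smul]
        congr 1
        ring
      -- At `i = σ + 1` the variable `s 1` is absent; the truncated exponent is harmless because its
      -- numerical factor is zero.
      · refine IsPolyFamily.zero.congr fun q _ s => ?_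
        rw [Nat.sub_eq_zero_of_le hi]
        simp
    have h2 : IsPolyFamily σ r D (fun q s => (s 1 ^ (σ + 1 - i) *
        ((i : ℂ) * s 0 ^ ((i : ℕ) - 1) * (Pi.single B' 1 : Fin 2 → ℂ) 0)) • c i q) := by
      rcases Nat.eq_zero_or_pos (i : ℕ) with hi | hi
      · refine IsPolyFamily.zero.congr fun q _ s => ?_
        rw [hi]
        simp
      · have h := (IsPolyFamily.monomial (hc i) (i - 1) (σ + 1 - i)).smul
          (contDiffOn_const (c := (i : ℂ) * (Pi.single B' 1 : Fin 2 → ℂ) 0))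
        rw [show (i : ℕ) - 1 + (σ + 1 - i) = σ by omega] at h
        refine h.congr fun q _ s => ?_
        rw [smul_smul]
        congr 1
        ring
    exact (h1.add h2).congr fun q _ s => by rw [add_smul]
  · simp only [(hfd q hq s).fderiv, _root_.sum_apply, ContinuousLinearMap.smulRight_apply,
      _root_.add_apply, _root_.smul_apply, ContinuousLinearMap.proj_apply, smul_eq_mul]

/-- The coefficients of a smooth family of homogeneous polynomials are smooth. -/
lemma isPolyFamily_of_forall (hf : ∀ q ∈ D, IsHomogeneousPoly σ (f q))
    (hs : ∀ s, ContDiffOn ℝ r (fun q => f q s) D) : IsPolyFamily σ r D f := by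
  -- Interpolation at the `σ + 1` points `(m, 1)`: inverting the Vandermonde matrix writes each
  -- coefficient as a fixed linear combination of values of `f q`, hence `C^r` in `q`.
  let v : Fin (σ + 1) → ℂ := fun i => ((i : ℕ) : ℂ)
  have hdet : IsUnit (Matrix.vandermonde v).det := by
    rw [isUnit_iff_ne_zero, Matrix.det_vandermonde_ne_zero_iff]
    intro i j hij
    exact Fin.ext (by simpa [v] using hij)
  let W := (Matrix.vandermonde v)⁻¹
  refine ⟨fun i q => ∑ m, W i m • f q ![v m, 1], fun i => ?_, fun q hq s => ?_⟩
  · exact ContDiffOn.sum fun m _ => (hs _).const_smul _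
  · obtain ⟨c, hc⟩ := hf q hq
    rw [hc]
    refine Finset.sum_congr rfl fun i _ => ?_
    congr 1
    have h1 (m : Fin (σ + 1)) : f q ![v m, 1] = ∑ l, Matrix.vandermonde v m l • c l := by
      rw [hc]
      simp [Matrix.vandermonde_apply]
    simp only [h1, Finset.smul_sum, smul_smul]
    rw [Finset.sum_comm]
    simp only [← Finset.sum_smul, ← Matrix.mul_apply, W, Matrix.nonsing_inv_mul _ hdet,
      Matrix.one_apply]
    simp

end Poly

lemma isSection_iff {k j : ℕ} {r : WithTop ℕ∞} {D : Set (Hn n)} {f : SuperFun n (extDeg k j)} :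
    IsSection k j r D f ↔ IsPolyFamily (symDeg k j) r D f := by
  refine ⟨fun h => isPolyFamily_of_forall h.1 h.2, ?_⟩
  rintro ⟨c, hc, hfc⟩
  refine ⟨fun q hq => ⟨fun i => c i q, hfc q hq⟩, fun s => ?_⟩
  exact (ContDiffOn.sum (s := Finset.univ) fun i _ =>
    (hc i).const_smul (s 0 ^ (i : ℕ) * s 1 ^ (symDeg k j - i))).congr fun q hq => hfc q hq s

end

noncomputable section

variable {n τ : ℕ} {r : WithTop ℕ∞} {D : Set (Hn n)}

/-! ### Smoothness of the operators and of the action -/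

lemma dForm_eq_sum (A' : Fin 2) (f : Hn n → Lam n τ) (q : Hn n) :
    dForm A' f q = ∑ A, extMul n τ
      (ContinuousLinearMap.proj (R := ℂ) (φ := fun _ : Fin n × Fin 2 => ℂ) A)
      (complexCoeff (fderiv ℝ f q) A A') := by
  simp only [dForm, complexPart, alternatize_sum, extMul_apply]

lemma contDiffOn_complexCoeff_fderiv {E : Type*} [NormedAddCommGroup E] [NormedSpace ℂ E]
    [NormedSpace ℝ E] [IsScalarTower ℝ ℂ E] {f : Hn n → E} {m : WithTop ℕ∞} (hD : IsOpen D)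
    (hf : ContDiffOn ℝ m f D) (hm : r + 1 ≤ m) (A : Fin n × Fin 2) (A' : Fin 2) :
    ContDiffOn ℝ r (fun q => complexCoeff (fderiv ℝ f q) A A') D := by
  have h (v : Hn n) : ContDiffOn ℝ r (fun q => fderiv ℝ f q v) D :=
    (hf.fderiv_of_isOpen hD hm).clm_apply contDiffOn_const
  obtain ⟨l, α⟩ := A
  have h0 := h (Pi.single l 1)
  have hI := h (Pi.single l unitI)
  have hJ := h (Pi.single l unitJ)
  have hK := h (Pi.single l unitK)
  fin_cases α <;> fin_cases A'
  · exact (h0.add (hI.const_smul Complex.I)).const_smul (1 / 2 : ℂ)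
  · exact (hJ.neg.sub (hK.const_smul Complex.I)).const_smul (1 / 2 : ℂ)
  · exact (hJ.sub (hK.const_smul Complex.I)).const_smul (1 / 2 : ℂ)
  · exact (h0.sub (hI.const_smul Complex.I)).const_smul (1 / 2 : ℂ)

lemma contDiffOn_dForm {f : Hn n → Lam n τ} {m : WithTop ℕ∞} (hD : IsOpen D)
    (hf : ContDiffOn ℝ m f D) (hm : r + 1 ≤ m) (A' : Fin 2) :
    ContDiffOn ℝ r (dForm A' f) D := by
  refine ContDiffOn.congr (ContDiffOn.sum (s := Finset.univ) fun A _ => ?_)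
    fun q _ => dForm_eq_sum A' f q
  exact ((extMul n τ (ContinuousLinearMap.proj (R := ℂ) (φ := fun _ : Fin n × Fin 2 => ℂ)
    A)).restrictScalars ℝ).contDiff.comp_contDiffOn (contDiffOn_complexCoeff_fderiv hD hf hm A A')

lemma dForm_congr {f g : Hn n → Lam n τ} (hD : IsOpen D) (hfg : ∀ q ∈ D, f q = g q) (A' : Fin 2)
    {q : Hn n} (hq : q ∈ D) : dForm A' f q = dForm A' g q := by
  have h : f =ᶠ[𝓝 q] g := Filter.eventuallyEq_of_mem (hD.mem_nhds hq) hfg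
  rw [dForm, dForm, h.fderiv_eq]

lemma IsPolyFamily.dOp {σ : ℕ} {f : SuperFun n τ} {m : WithTop ℕ∞} (hf : IsPolyFamily σ m D f)
    (hD : IsOpen D) (hm : r + 1 ≤ m) (A' : Fin 2) :
    IsPolyFamily σ r D (CauchyFueter.dOp A' f) := by
  obtain ⟨c, hc, hfc⟩ := hf
  refine ⟨fun i => dForm A' (c i), fun i => contDiffOn_dForm hD (hc i) hm A', fun q hq s => ?_⟩
  have hm0 : m ≠ 0 := by
    rintro rfl
    simp at hm
  rw [dOp_eq_dForm, dForm_congr hD (fun p hp => hfc p hp s) A' hq]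
  have hd (i : Fin (σ + 1)) : HasComplexDeriv (c i) _ q :=
    HasComplexDeriv.of_hasFDerivAt
      (((hc i).contDiffAt (hD.mem_nhds hq)).differentiableAt hm0).hasFDerivAt
  have hs := HasComplexDeriv.sum Finset.univ (q := q)
    (f := fun (i : Fin (σ + 1)) p => (s 0 ^ (i : ℕ) * s 1 ^ (σ - i)) • c i p)
    fun i _ => (HasComplexDeriv.const (s 0 ^ (i : ℕ) * s 1 ^ (σ - i)) q).smul (hd i)
  rw [hs.dForm_eq, alternatize_sum]
  refine Finset.sum_congr rfl fun i _ => ?_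
  beta_reduce
  rw [(hd i).dForm_eq, ← alternatize_smul]
  congr 1
  ext1 w
  simp

lemma IsPolyFamily.castDeg {σ : ℕ} {a b : ℕ} (hab : a = b) {f : SuperFun n a}
    (hf : IsPolyFamily σ r D f) :
    IsPolyFamily σ r D (fun q s => CauchyFueter.castDeg hab (f q s)) := by
  subst hab
  exact hf

lemma castDeg_smul_pull {a b : ℕ} (hab : a = b) (c : ℂ) (M : Cn n →L[ℂ] Cn n) (φ : Lam n a) :
    castDeg hab (c • pull M φ) = c • pull M (castDeg hab φ) := by
  subst hab
  rfl

/-- The operators of the complex, with values in homogeneous polynomials. -/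
lemma isSection_cauchyFueter {k j : ℕ} {f : SuperFun n (extDeg k j)} (hD : IsOpen D)
    (hf : IsSection k j (r + order k j) D f) :
    IsSection k (j + 1) r D (cauchyFueter k j f) := by
  rw [isSection_iff] at hf ⊢
  rcases lt_trichotomy j k with hjk | rfl | hjk
  · have ho : order k j = 1 := by simp [order, hjk.ne]
    have hs : symDeg k j = symDeg k (j + 1) + 1 := by
      unfold symDeg
      split_ifs <;> omega
    rw [ho, hs] at hf
    rw [cauchyFueter, dif_pos hjk]
    refine IsPolyFamily.castDeg (f := fun q s => ∑ A', dUp A' (dOp A' f) q s) _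
      (IsPolyFamily.sum _ fun A' _ => IsPolyFamily.sum _ fun B' _ => ?_)
    exact ((hf.dOp hD (by simp) A').fderiv_apply B').smul contDiffOn_const
  · have ho : order j j = 2 := by simp [order]
    have hs : symDeg j j = symDeg j (j + 1) := by simp [symDeg]
    rw [ho, hs] at hf
    rw [cauchyFueter, dif_neg (lt_irrefl j), dif_pos rfl]
    refine IsPolyFamily.castDeg (f := fun q s => dOp 0 (dOp 1 f) q s) _ ?_
    have h2 : r + 1 + 1 ≤ r + ((2 : ℕ) : WithTop ℕ∞) := by
      rw [add_assoc]
      norm_num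
    exact (hf.dOp hD h2 1).dOp hD le_rfl 0
  · have ho : order k j = 1 := by simp [order, hjk.ne']
    have hs : symDeg k (j + 1) = symDeg k j + 1 := by
      unfold symDeg
      split_ifs <;> omega
    rw [ho] at hf
    rw [hs, cauchyFueter, dif_neg hjk.not_gt, dif_neg hjk.ne']
    refine IsPolyFamily.castDeg (f := fun q s => ∑ A', mulSUp A' (dOp A' f) q s) _
      (IsPolyFamily.sum _ fun A' _ => IsPolyFamily.sum _ fun B' _ => ?_)
    refine ((((hf.dOp hD (by simp) A').mul_coord B').smul
      (contDiffOn_const (c := eps B' A')))).congr fun q _ s => ?_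
    rw [smul_smul, mul_comm]

/-! ### Smoothness of the cocycles and of the pullback off the singular hyperplane. -/

variable {h : SLH n}

lemma contDiff_J1 : ContDiff ℝ r (J1 h) := by
  rw [J1_eq]
  exact contDiff_const.add (bLin h).contDiff

lemma isOpen_J1_ne_zero : IsOpen {q | J1 h q ≠ 0} :=
  isOpen_ne.preimage (contDiff_J1 (r := 0)).continuous

lemma contDiffOn_J1_inv : ContDiffOn ℝ r (fun q => (J1 h q)⁻¹) {q | J1 h q ≠ 0} :=
  fun q hq => by
  have hi := contDiffAt_ringInverse (n := r) ℝ (Units.mk0 (J1 h q) hq)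
  rw [Ring.inverse_eq_inv'] at hi
  exact (hi.comp q contDiff_J1.contDiffAt).contDiffWithinAt

lemma contDiffOn_act : ContDiffOn ℝ r (act h) {q | J1 h q ≠ 0} := by
  rw [contDiffOn_pi]
  intro l
  refine ContDiffOn.congr (((contDiff_const (c := blockC h l)).add
    (dLin h l).contDiff).contDiffOn.mul contDiffOn_J1_inv) fun q _ => act_eq h q l

lemma contDiffOn_kMat (A' B' : Fin 2) :
    ContDiffOn ℝ r (fun q => kMat h q A' B') {q | J1 h q ≠ 0} :=
  (tauEntry A' B').contDiff.comp_contDiffOn contDiffOn_J1_inv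

lemma contDiffOn_det_kMat : ContDiffOn ℝ r (fun q => (kMat h q).det) {q | J1 h q ≠ 0} := by
  simp only [Matrix.det_fin_two]
  exact ((contDiffOn_kMat 0 0).mul (contDiffOn_kMat 1 1)).sub
    ((contDiffOn_kMat 0 1).mul (contDiffOn_kMat 1 0))

lemma contDiffOn_jMap : ContDiffOn ℝ r (jMap h) {q | J1 h q ≠ 0} := by
  refine ContDiffOn.congr (contDiffOn_const.sub (ContDiffOn.sum (s := Finset.univ) fun B' _ =>
    ((ContinuousLinearMap.smulRightL ℂ (Cn n) (Cn n) (bCov h B')).restrictScalars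
      ℝ).contDiff.comp_contDiffOn ((col B').contDiff.comp_contDiffOn contDiffOn_act)))
    fun q _ => jMap_eq h q

instance : FiniteDimensional ℂ (ContinuousMultilinearMap ℂ (fun _ : Fin τ => Cn n) ℂ) :=
  Module.Finite.of_injective
    ({ toFun := ContinuousMultilinearMap.toMultilinearMap
       map_add' := fun _ _ => rfl
       map_smul' := fun _ _ => rfl } :
      ContinuousMultilinearMap ℂ (fun _ : Fin τ => Cn n) ℂ →ₗ[ℂ]
        MultilinearMap ℂ (fun _ : Fin τ => Cn n) ℂ)
    ContinuousMultilinearMap.toMultilinearMap_injective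

/-- The pullback by `M` is a continuous multilinear expression evaluated on the diagonal `(M, …,
M)`. A left inverse of the inclusion of alternating into multilinear maps, continuous by finite
dimension, brings the values back to `Lam n τ`. -/
lemma contDiff_pull :
    ContDiff ℂ r (fun M : Cn n →L[ℂ] Cn n => (pull M : Lam n τ →L[ℂ] Lam n τ)) := by
  let T : Lam n τ →L[ℂ] ContinuousMultilinearMap ℂ (fun _ : Fin τ => Cn n) ℂ :=
    ContinuousAlternatingMap.toContinuousMultilinearMapCLM ℂ
  have hT : Function.Injective T := ContinuousAlternatingMap.toContinuousMultilinearMap_injective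
  obtain ⟨S, hS⟩ := LinearMap.exists_leftInverse_of_injective T.toLinearMap
    (LinearMap.ker_eq_bot.2 hT)
  let S' : ContinuousMultilinearMap ℂ (fun _ : Fin τ => Cn n) ℂ →L[ℂ] Lam n τ :=
    LinearMap.toContinuousLinearMap S
  let C := ContinuousMultilinearMap.compContinuousLinearMapContinuousMultilinear ℂ
    (fun _ : Fin τ => Cn n) (fun _ : Fin τ => Cn n) ℂ
  have h : (fun M : Cn n →L[ℂ] Cn n => (pull M : Lam n τ →L[ℂ] Lam n τ)) =
      fun M => S' ∘L (C fun _ => M) ∘L T := by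
    funext M
    refine ContinuousLinearMap.ext fun φ => ?_
    exact (LinearMap.congr_fun hS (pull M φ)).symm
  rw [h]
  exact contDiff_const.clm_comp
    ((C.contDiff.comp (contDiff_pi.2 fun _ => contDiff_id)).clm_comp contDiff_const)

lemma contDiffOn_pull_jMap :
    ContDiffOn ℝ r (fun q => (pull (jMap h q) : Lam n τ →L[ℂ] Lam n τ)) {q | J1 h q ≠ 0} :=
  (contDiff_pull.restrict_scalars ℝ).comp_contDiffOn contDiffOn_jMap

end

noncomputable section

variable {n : ℕ} {r : WithTop ℕ∞} {D : Set (Hn n)} {k j : ℕ} {g : SLH n}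

/-! ### Equivariance -/

lemma isOpen_regularSet (hD : IsOpen D) : IsOpen (regularSet g D) :=
  (contDiffOn_act (r := 0)).continuousOn.isOpen_inter_preimage isOpen_J1_ne_zero hD

lemma regularSet_subset : regularSet g D ⊆ {q | J1 g⁻¹ q ≠ 0} := fun _ hq => hq.1

lemma inv_norm_pow_smul (h : SLH n) (q : Hn n) (e : ℕ) {τ : ℕ} (φ : Lam n τ) :
    (‖J1 h q‖ ^ (2 * e))⁻¹ • φ = (kMat h q).det ^ e • φ := by
  rw [det_kMat, ← Complex.ofReal_pow, inv_pow, ← pow_mul]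
  exact (algebraMap_smul ℂ _ φ).symm

/-- In terms of the form degree, the exponent `j + 1` is degree plus one here and equals the degree
when `j > k`. -/
lemma piAct_of_le (hj : j ≤ k) (f : SuperFun n (extDeg k j)) :
    piAct k j g f = fun q s =>
      twist g⁻¹ (extDeg k j + 1) (fun p => f (act g⁻¹ p) (kAct g⁻¹ p s)) q := by
  funext q s
  rw [piAct, inv_norm_pow_smul, if_pos hj, actOmega_eq_pull, twist]
  have hs : kAct g⁻¹ q s = fun A' => ∑ B', tau (J1 g⁻¹ q)⁻¹ B' A' * s B' :=
    funext fun A' => kAct_apply _ _ _ _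
  simp only [extDeg, if_pos hj, actS, hs]

lemma piAct_of_lt (hj : k < j) (f : SuperFun n (extDeg k j)) :
    piAct k j g f = fun q s =>
      twist g⁻¹ (extDeg k j) (fun p => f (act g⁻¹ p) (jAct g⁻¹ p s)) q := by
  funext q s
  rw [piAct, inv_norm_pow_smul, if_neg hj.not_ge, actOmega_eq_pull, twist]
  simp only [extDeg, if_neg hj.not_ge, actS]
  rfl

lemma IsPolyFamily.twist {τ σ : ℕ} {f : SuperFun n τ} (hf : IsPolyFamily σ r D f)
    {N : Fin 2 → Fin 2 → Hn n → ℂ} (hN : ∀ A' B', ContDiffOn ℝ r (N A' B') {q | J1 g⁻¹ q ≠ 0})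
    {u : Hn n → (Fin 2 → ℂ) → Fin 2 → ℂ} (hu : ∀ q s A', u q s A' = ∑ B', N A' B' q * s B')
    (e : ℕ) :
    IsPolyFamily σ r (regularSet g D)
      (fun q s => CauchyFueter.twist g⁻¹ e (fun p => f (act g⁻¹ p) (u p s)) q) :=
  ((hf.subst (contDiffOn_act.mono regularSet_subset) (fun _ hq => hq.2)
    (fun A' B' => (hN A' B').mono regularSet_subset) hu).clm
      (contDiffOn_pull_jMap.mono regularSet_subset)).smul
        ((contDiffOn_det_kMat.pow e).mono regularSet_subset)

lemma isSection_piAct {f : SuperFun n (extDeg k j)} (hf : IsSection k j r D f) :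
    IsSection k j r (regularSet g D) (piAct k j g f) := by
  rw [isSection_iff] at hf ⊢
  rcases le_or_gt j k with hj | hj
  · rw [piAct_of_le hj]
    exact hf.twist (N := fun A' B' q => kMat g⁻¹ q B' A') (fun A' B' => contDiffOn_kMat B' A')
      (fun q s A' => kAct_apply _ _ _ _) _
  · rw [piAct_of_lt hj]
    exact hf.twist (N := fun A' B' q => tau (J1 g⁻¹ q) A' B')
      (fun A' B' => ((tauEntry A' B').contDiff.comp contDiff_J1).contDiffOn)
      (fun q s A' => rfl) _

lemma cauchyFueter_piAct_of_lt (hjk : j < k) (hD : IsOpen D) {f : SuperFun n (extDeg k j)}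
    (hf : IsSection k j 1 D f) {q : Hn n} (hq : q ∈ regularSet g D) :
    cauchyFueter k j (piAct k j g f) q = piAct k (j + 1) g (cauchyFueter k j f) q := by
  rw [isSection_iff] at hf
  funext s
  rw [piAct_of_le hjk.le, piAct_of_le hjk]
  simp only [cauchyFueter, dif_pos hjk]
  rw [sum_dUp_dOp_twist hq.1 (hf.differentiableAt le_rfl hD hq.2) (hf.contDiff hq.2) fun B' =>
    ((hf.dOp (r := 0) hD (by simp) B').contDiff hq.2 (m := 1)).differentiable one_ne_zero,
    castDeg_smul_pull, twist]
  congr 2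
  simp only [extDeg, if_pos hjk.le, if_pos (Nat.succ_le_of_lt hjk)]

lemma cauchyFueter_piAct_of_gt (hjk : k < j) (hD : IsOpen D) {f : SuperFun n (extDeg k j)}
    (hf : IsSection k j 1 D f) {q : Hn n} (hq : q ∈ regularSet g D) :
    cauchyFueter k j (piAct k j g f) q = piAct k (j + 1) g (cauchyFueter k j f) q := by
  rw [isSection_iff] at hf
  funext s
  rw [piAct_of_lt hjk, piAct_of_lt (hjk.trans j.lt_succ_self)]
  simp only [cauchyFueter, dif_neg hjk.not_gt, dif_neg hjk.ne']
  rw [sum_mulSUp_dOp_twist hq.1 (hf.differentiableAt le_rfl hD hq.2)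
    ((hf.contDiff hq.2 (m := 1)).differentiable one_ne_zero), castDeg_smul_pull, twist]
  congr 2
  simp only [extDeg, if_neg hjk.not_ge, if_neg (hjk.trans j.lt_succ_self).not_ge]

lemma cauchyFueter_piAct_self (hD : IsOpen D) {f : SuperFun n (extDeg k k)}
    (hf : IsSection k k 2 D f) {q : Hn n} (hq : q ∈ regularSet g D) :
    cauchyFueter k k (piAct k k g f) q = piAct k (k + 1) g (cauchyFueter k k f) q := by
  obtain ⟨hpoly, hsm⟩ := hf
  -- For `j = k` the degree in `s` is zero, so the differing substitutions `kAct` and `jAct` on the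
  -- two sides do not matter.
  have hs (p : Hn n) (hp : p ∈ D) (s t : Fin 2 → ℂ) : f p s = f p t := by
    obtain ⟨c, hc⟩ := hpoly p hp
    rw [hc, hc]
    refine Finset.sum_congr rfl fun i _ => ?_
    have h0 : symDeg k k = 0 := by simp [symDeg]
    have hi : (i : ℕ) = 0 := by omega
    simp [hi, h0]
  have hU := isOpen_regularSet (g := g) hD
  funext s
  rw [piAct_of_le le_rfl, piAct_of_lt k.lt_succ_self]
  simp only [cauchyFueter, dif_neg (lt_irrefl k), dif_pos]
  rw [dOp_eq_dForm]
  simp only [dOp_eq_dForm]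
  rw [dForm_congr hU (g := dForm 1 (twist g⁻¹ (extDeg k k + 1) fun p => f (act g⁻¹ p) 0))
      (fun p hp => dForm_congr hU (fun p' hp' => ?_) 1 hp) 0 hq,
    dForm_dForm_twist hD (hsm 0) hU (fun _ hp => hp) hq, castDeg_smul_pull, twist,
    dForm_congr hD (g := dForm 1 fun p => f p (jAct g⁻¹ q s))
      (fun p hp => dForm_congr hD (fun p' hp' => hs p' hp' _ _) 1 hp) 0 hq.2]
  · congr 2
    simp [extDeg]
  · rw [twist, twist, hs _ hp'.2 _ 0]

lemma cauchyFueter_piAct (hD : IsOpen D) {f : SuperFun n (extDeg k j)}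
    (hf : IsSection k j (r + order k j) D f) {q : Hn n} (hq : q ∈ regularSet g D) :
    cauchyFueter k j (piAct k j g f) q = piAct k (j + 1) g (cauchyFueter k j f) q := by
  have hf' : IsSection k j (order k j) D f :=
    ⟨hf.1, fun s => (hf.2 s).of_le le_add_self⟩
  rcases lt_trichotomy j k with hjk | rfl | hjk
  · refine cauchyFueter_piAct_of_lt hjk hD ?_ hq
    simpa [order, hjk.ne] using hf'
  · refine cauchyFueter_piAct_self hD ?_ hq
    simpa [order] using hf'
  · refine cauchyFueter_piAct_of_gt hjk hD ?_ hq
    simpa [order, hjk.ne'] using hf'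

/-! ### Regular functions -/

/-- The inhomogeneous coordinates `(1, q)`. -/
def homog (q : Hn n) : Fin (n + 1) → ℍ[ℝ] := Fin.cons 1 q

/-- The fractional linear map is the linear action on right quaternionic lines, read in the chart
`(1, q)`; `J₁` is the normalizing factor. Composition laws thus reduce to matrix products. -/
lemma mulVec_homog {h : SLH n} {q : Hn n} (hq : J1 h q ≠ 0) :
    h.val.val.mulVec (homog q) = fun i => homog (act h q) i * J1 h q := by
  funext i
  refine Fin.cases ?_ (fun l => ?_) i
  · simp [homog, Matrix.mulVec, dotProduct, Fin.sum_univ_succ, J1, blockA, blockB]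
  · have h1 : act h q l * J1 h q = blockC h l + ∑ m, blockD h l m * q m := by
      rw [act, inv_mul_cancel_right₀ hq]
    simp only [homog, Fin.cons_succ, h1]
    simp [Matrix.mulVec, dotProduct, Fin.sum_univ_succ, blockC, blockD]

lemma act_inv_act {p : Hn n} (hp : J1 g p ≠ 0) (hq : J1 g⁻¹ (act g p) ≠ 0) :
    act g⁻¹ (act g p) = p := by
  have h1 : (g⁻¹).val.val.mulVec (g.val.val.mulVec (homog p)) = homog p := by
    rw [Matrix.mulVec_mulVec]
    have : (g⁻¹).val.val * g.val.val = 1 := by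
      rw [← Units.val_mul, ← Subgroup.coe_mul, inv_mul_cancel]
      rfl
    rw [this, Matrix.one_mulVec]
  have h2 : (g⁻¹).val.val.mulVec (g.val.val.mulVec (homog p)) =
      fun i => homog (act g⁻¹ (act g p)) i * J1 g⁻¹ (act g p) * J1 g p := by
    rw [mulVec_homog hp]
    funext i
    have := congrFun (mulVec_homog hq) i
    rw [← this]
    simp only [Matrix.mulVec, dotProduct, Finset.sum_mul, mul_assoc]
  rw [h1] at h2
  have h0 : 1 = J1 g⁻¹ (act g p) * J1 g p := by simpa [homog] using congrFun h2 0
  funext l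
  have hl : p l = act g⁻¹ (act g p) l * J1 g⁻¹ (act g p) * J1 g p := congrFun h2 l.succ
  rw [hl, mul_assoc, ← h0, mul_one]

lemma image_diff_singularSet_subset : image g D \ singularSet g ⊆ regularSet g D := by
  rintro _ ⟨⟨p, hp, hgp, rfl⟩, hq⟩
  exact ⟨hq, by rwa [act_inv_act hgp hq]⟩

lemma piAct_zero (f : SuperFun n (extDeg k 0)) :
    piAct k 0 g f = fun q => (‖J1 g⁻¹ q‖ ^ 2)⁻¹ •
      actS (tau (J1 g⁻¹ q)⁻¹) (f (act g⁻¹ q)) := by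
  have h0 (M : Matrix (Fin n × Fin 2) (Fin n × Fin 2) ℂ) (φ : Lam n (extDeg k 0)) :
      actOmega M φ = φ := by
    have : extDeg k 0 = 0 := by simp [extDeg]
    -- The degree equals `0` only propositionally, so it is made a variable before substituting; on
    -- `0`-forms the pullback is trivial.
    generalize extDeg k 0 = τ at φ this
    subst this
    ext v
    exact congrArg φ (Subsingleton.elim _ _)
  funext q s
  rw [piAct, h0, if_pos k.zero_le]
  rfl

lemma isRegularOn_piAct (hD : IsOpen D) {f : SuperFun n (extDeg k 0)} (hf : IsRegularOn k D f) :
    IsRegularOn k (regularSet g D) (piAct k 0 g f) := by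
  refine ⟨isSection_piAct hf.1, fun q hq => ?_⟩
  rw [cauchyFueter_piAct (r := 0) hD (by simpa using hf.1) hq]
  funext s
  rw [piAct, hf.2 _ hq.2]
  rw [inv_norm_pow_smul, actOmega_eq_pull]
  exact (congrArg _ (map_zero (pull (jMap g⁻¹ q)))).trans (smul_zero _)

end

end CauchyFueter

theorem theorem1p1 (n k : ℕ) (g : CauchyFueter.SLH n) :
    (∀ (j : ℕ) (r : WithTop ℕ∞) (D : Set (CauchyFueter.Hn n)), IsOpen D →
      ∀ f : CauchyFueter.SuperFun n (CauchyFueter.extDeg k j),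
        CauchyFueter.IsSection k j (r + CauchyFueter.order k j) D f →
          CauchyFueter.IsSection k (j + 1) r D (CauchyFueter.cauchyFueter k j f) ∧
          CauchyFueter.IsSection k j (r + CauchyFueter.order k j) (CauchyFueter.regularSet g D)
            (CauchyFueter.piAct k j g f) ∧
          ∀ q ∈ CauchyFueter.regularSet g D,
            CauchyFueter.cauchyFueter k j (CauchyFueter.piAct k j g f) q =
              CauchyFueter.piAct k (j + 1) g (CauchyFueter.cauchyFueter k j f) q) ∧
    (∀ D : Set (CauchyFueter.Hn n), IsOpen D →
      ∀ f : CauchyFueter.SuperFun n (CauchyFueter.extDeg k 0),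
        CauchyFueter.IsRegularOn k D f →
          CauchyFueter.IsRegularOn k (CauchyFueter.image g D \ CauchyFueter.singularSet g)
            (fun q => (‖CauchyFueter.J1 g⁻¹ q‖ ^ 2)⁻¹ •
              CauchyFueter.actS (CauchyFueter.tau (CauchyFueter.J1 g⁻¹ q)⁻¹)
                (f (CauchyFueter.act g⁻¹ q)))) := by
  refine ⟨fun j r D hD f hf => ⟨CauchyFueter.isSection_cauchyFueter hD hf,
    CauchyFueter.isSection_piAct hf, fun q hq => CauchyFueter.cauchyFueter_piAct hD hf hq⟩,
    fun D hD f hf => ?_⟩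
  rw [← CauchyFueter.piAct_zero]
  have h := CauchyFueter.isRegularOn_piAct (g := g) hD hf
  -- The operator at `q` uses the globally defined function, so its vanishing restricts pointwise to
  -- the smaller set.
  have hs := CauchyFueter.image_diff_singularSet_subset (g := g) (D := D)
  exact ⟨⟨fun q hq => h.1.1 q (hs hq), fun s => (h.1.2 s).mono hs⟩, fun q hq => h.2 q (hs hq)⟩
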